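/- Let $n,m,r$ be positive integers, let $A\in\mathbf R^{n\times n}$ be symmetric positive definite and $B\in\mathbf R^{n\times m}$. Write $\mathrm{Sym}(r)$ and $\mathrm{Sym}_+(r)$ for the symmetric and the symmetric positive definite real $r\times r$ matrices and $\mathrm{sym}(M)=\frac12(M+M^T)$. On $\tilde M=\mathrm{Sym}_+(r)\times\mathbf R^{r\times m}$, an open subset of $\mathrm{Sym}(r)\times\mathbf R^{r\times m}$, consider $$\tilde J(A_r,B_r)=\bigl\|B^T(sI_n+A)^{-1}B-B_r^T(sI_r+A_r)^{-1}B_r\bigr\|_{H^2}^2,\qquad \|G\|_{H^2}^2=\frac1{2\pi}\int_{-\infty}^{\infty}\|G(it)\|_F^2\,dt,$$ and let $\bar{\tilde J}$ be the extension of $\tilde J$ to $\mathbf R^{r\times r}\times\mathbf R^{r\times m}$ that is given by the same formula (near $\tilde M$ the integral converges). Let $(A_r,B_r)\in\tilde M$, $C=B^T$ and $C_r=B_r^T$. Then the error transfer function at $(A_r,B_r)$ has finite $H^2$ norm, and each of the equations $$A_rP+PA_r-B_rB_r^T=0,\quad A_rQ+QA_r-C_r^TC_r=0,\quad AX+XA_r-BB_r^T=0,\quad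 AY+YA_r+C^TC_r=0$$ has exactly one solution. These satisfy $P=Q$ and $X=-Y$, and the following hold. (1) With respect to the trace inner products, $\bar{\tilde J}$ is differentiable at $(A_r,B_r)$ with Euclidean gradient $$\nabla\bar{\tilde J}(A_r,B_r)=\bigl(-2(P^2-X^TX),\;4PB_r-4X^TB\bigr).$$ (2) With respect to the Riemannian metric $\langle(\xi_1,\eta_1),(\xi_2,\eta_2)\rangle_{(A_r,B_r)}=\mathrm{tr}(A_r^{-1}\xi_1A_r^{-1}\xi_2)+\mathrm{tr}(\eta_1^T\eta_2)$ on $\tilde M$, $$\mathrm{grad}\,\tilde J(A_r,B_r)=\bigl(-2A_r\,\mathrm{sym}(P^2-X^TX)A_r,\;4PB_r-4X^TB\bigr).$$ (3) For every tangent vector $(A_r',B_r')\in\mathrm{Sym}(r)\times\mathbf R^{r\times m}$, the equations $$A_rP'+P'A_r+A_r'P+PA_r'-B_r'B_r^T-B_rB_r'^T=0,\qquad AX'+X'A_r+XA_r'-BB_r'^T=0$$ have exactly one solution $P'$, respectively $X'$, and the Riemannian Hessian of $\tilde J$ (the covariant derivative, for the Levi-Civita connection of the metric in (2), of the vector field $\mathrm{grad}\,\tilde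 J$) is $$\begin{aligned}\mathrm{Hess}\,\tilde J(A_r,B_r)[(A_r',B_r')]=\bigl(&-2A_r\,\mathrm{sym}(P'P+PP'-X'^TX-X^TX')A_r-2\,\mathrm{sym}(A_r'\,\mathrm{sym}(P^2-X^TX)A_r),\\&4(P'B_r+PB_r')-4X'^TB\bigr).\end{aligned}$$ In particular only $P$, $X$, $P'$ and $X'$ enter the formulas for the gradient and the Hessian. -/

import Mathlib

open Matrix MeasureTheory
open scoped ContDiff

-- The Euclidean (Frobenius) norm on real matrices.
attribute [local instance] Matrix.frobeniusNormedAddCommGroup Matrix.frobeniusNormedSpace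

noncomputable section

/-! ### Riemannian geometry on an open subset of a vector space

Every tangent space of an open subset `U` of a finite-dimensional real vector space `E` is `E`. -/

/-- A smooth Riemannian metric on an open subset `U` of `E`. -/
structure RiemannianMetricOn (E : Type*) [NormedAddCommGroup E] [NormedSpace ℝ E]
    (U : Set E) where
  isOpen : IsOpen U
  inner : E → E →ₗ[ℝ] E →ₗ[ℝ] ℝ
  symm : ∀ x ∈ U, ∀ v w, inner x v w = inner x w v
  pos : ∀ x ∈ U, ∀ v, v ≠ 0 → 0 < inner x v v
  smooth : ∀ v w, ContDiffOn ℝ ∞ (fun x => inner x v w) U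

namespace RiemannianMetricOn

variable {E : Type*} [NormedAddCommGroup E] [NormedSpace ℝ E] {U : Set E}

/-- `v` is the Riemannian gradient of `f` at `x`: `D f(x)[ξ] = ⟨v, ξ⟩_x` for all `ξ`. -/
def HasGradientAt (g : RiemannianMetricOn E U) (f : E → ℝ) (x v : E) : Prop :=
  DifferentiableAt ℝ f x ∧ ∀ ξ, fderiv ℝ f x ξ = g.inner x v ξ

/-- `Γ` is the Christoffel map of the Levi-Civita connection `∇_ξ V = D V[ξ] + Γ(ξ, V)` on `U`,
that is, of the torsion-free connection with
`u ⟨V, W⟩ = ⟨∇_u V, W⟩ + ⟨V, ∇_u W⟩` (stated here for constant fields `V = v`, `W = w`). -/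
structure IsLeviCivita (g : RiemannianMetricOn E U) (Γ : E → E →ₗ[ℝ] E →ₗ[ℝ] E) : Prop where
  torsion_free : ∀ x ∈ U, ∀ u v, Γ x u v = Γ x v u
  metric : ∀ x ∈ U, ∀ u v w,
    fderiv ℝ (fun y => g.inner y v w) x u = g.inner x (Γ x u v) w + g.inner x v (Γ x u w)

/-- `w` is the Riemannian Hessian `Hess f(x)[ξ] = ∇_ξ grad f` of `f` at `x` in the direction `ξ`,
where `∇` is the Levi-Civita connection. -/
def HasHessianAt (g : RiemannianMetricOn E U) (f : E → ℝ) (x ξ w : E) : Prop :=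
  ∃ (V : E → E) (Γ : E → E →ₗ[ℝ] E →ₗ[ℝ] E),
    (∀ y ∈ U, g.HasGradientAt f y (V y)) ∧ g.IsLeviCivita Γ ∧
    DifferentiableAt ℝ V x ∧ w = fderiv ℝ V x ξ + Γ x ξ (V x)

end RiemannianMetricOn

/-! ### Linear systems and the `H²` norm -/

/-- The transfer function `G(s) = C (s I + A)⁻¹ B` of `ẋ = -A x + B u`, `y = C x`. -/
def transferFunction {n m p : ℕ} (A : Matrix (Fin n) (Fin n) ℝ) (B : Matrix (Fin n) (Fin m) ℝ)
    (C : Matrix (Fin p) (Fin n) ℝ) (s : ℂ) : Matrix (Fin p) (Fin m) ℂ :=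
  C.map Complex.ofReal * (s • (1 : Matrix (Fin n) (Fin n) ℂ) + A.map Complex.ofReal)⁻¹ *
    B.map Complex.ofReal

/-- The squared Frobenius norm of a complex matrix. -/
def frobeniusSq {p m : ℕ} (M : Matrix (Fin p) (Fin m) ℂ) : ℝ := ∑ i, ∑ j, ‖M i j‖ ^ 2

/-- The `H²` norm `‖G‖ = ((1/2π) ∫ ‖G(it)‖_F² dt)^{1/2}` of a transfer function. -/
def h2Norm {p m : ℕ} (G : ℂ → Matrix (Fin p) (Fin m) ℂ) : ℝ :=
  Real.sqrt ((2 * Real.pi)⁻¹ * ∫ t : ℝ, frobeniusSq (G (Complex.I * t)))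

/-- The integral that defines the `H²` norm converges. -/
def HasFiniteH2Norm {p m : ℕ} (G : ℂ → Matrix (Fin p) (Fin m) ℂ) : Prop :=
  Integrable (fun t : ℝ => frobeniusSq (G (Complex.I * t)))

/-- The transfer function of the error between the systems `(A, B, Bᵀ)` and `(Ar, Br, Brᵀ)`. -/
def gradientErrorSystem {n m r : ℕ} (A : Matrix (Fin n) (Fin n) ℝ) (B : Matrix (Fin n) (Fin m) ℝ)
    (Ar : Matrix (Fin r) (Fin r) ℝ) (Br : Matrix (Fin r) (Fin m) ℝ) (s : ℂ) :
    Matrix (Fin m) (Fin m) ℂ :=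
  transferFunction A B Bᵀ s - transferFunction Ar Br Brᵀ s

/-- The objective function on the ambient space `ℝ^{r×r} × ℝ^{r×m}`:
the squared `H²` norm of the error system. -/
def objectiveExt {n m r : ℕ} (A : Matrix (Fin n) (Fin n) ℝ) (B : Matrix (Fin n) (Fin m) ℝ)
    (x : Matrix (Fin r) (Fin r) ℝ × Matrix (Fin r) (Fin m) ℝ) : ℝ :=
  h2Norm (gradientErrorSystem A B x.1 x.2) ^ 2

/-! ### The linear matrix equations -/

section Sylvester

variable {n m p r : ℕ} (A : Matrix (Fin n) (Fin n) ℝ) (B : Matrix (Fin n) (Fin m) ℝ)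
  (C : Matrix (Fin p) (Fin n) ℝ) (Ar : Matrix (Fin r) (Fin r) ℝ) (Br : Matrix (Fin r) (Fin m) ℝ)
  (Cr : Matrix (Fin p) (Fin r) ℝ)

def SolvesP (P : Matrix (Fin r) (Fin r) ℝ) : Prop :=
  Ar * P + P * Ar - Br * Brᵀ = 0

def SolvesQ (Q : Matrix (Fin r) (Fin r) ℝ) : Prop :=
  Ar * Q + Q * Ar - Crᵀ * Cr = 0

def SolvesX (X : Matrix (Fin n) (Fin r) ℝ) : Prop :=
  A * X + X * Ar - B * Brᵀ = 0

def SolvesY (Y : Matrix (Fin n) (Fin r) ℝ) : Prop :=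
  A * Y + Y * Ar + Cᵀ * Cr = 0

/-- The equation for `P'`, obtained from that for `P` by differentiation in the direction
`(A', B')`. -/
def SolvesP' (P A' : Matrix (Fin r) (Fin r) ℝ) (B' : Matrix (Fin r) (Fin m) ℝ)
    (P' : Matrix (Fin r) (Fin r) ℝ) : Prop :=
  Ar * P' + P' * Ar + A' * P + P * A' - B' * Brᵀ - Br * B'ᵀ = 0

/-- The equation for `X'`, obtained from that for `X` by differentiation in the direction
`(A', B')`. -/
def SolvesX' (X : Matrix (Fin n) (Fin r) ℝ) (A' : Matrix (Fin r) (Fin r) ℝ)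
    (B' : Matrix (Fin r) (Fin m) ℝ) (X' : Matrix (Fin n) (Fin r) ℝ) : Prop :=
  A * X' + X' * Ar + X * A' - B * B'ᵀ = 0

end Sylvester

/-! ### The manifold `Sym₊(r) × ℝ^{r×m}` -/

/-- The symmetric part `sym(M) = (M + Mᵀ)/2`. -/
def symPart {r : ℕ} (M : Matrix (Fin r) (Fin r) ℝ) : Matrix (Fin r) (Fin r) ℝ :=
  (1 / 2 : ℝ) • (M + Mᵀ)

/-- `Sym(r)`, the space of symmetric matrices. -/
def SymMat (r : ℕ) : Submodule ℝ (Matrix (Fin r) (Fin r) ℝ) where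
  carrier := {S | S.IsSymm}
  add_mem' := fun ha hb => ha.add hb
  zero_mem' := Matrix.isSymm_zero
  smul_mem' := fun c _ h => h.smul c

/-- `Sym(r) × ℝ^{r×m}`, the tangent space of `Sym₊(r) × ℝ^{r×m}` at each of its points. -/
abbrev TangentModel (r m : ℕ) : Type := SymMat r × Matrix (Fin r) (Fin m) ℝ

/-- `Sym₊(r) × ℝ^{r×m}`, as a subset of `Sym(r) × ℝ^{r×m}`. -/
def reducedManifold (r m : ℕ) : Set (TangentModel r m) :=
  {x | (x.1 : Matrix (Fin r) (Fin r) ℝ).PosDef}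

/-- The objective function `J̃` on `Sym₊(r) × ℝ^{r×m}`. -/
def objective {n m r : ℕ} (A : Matrix (Fin n) (Fin n) ℝ) (B : Matrix (Fin n) (Fin m) ℝ)
    (x : TangentModel r m) : ℝ :=
  objectiveExt A B ((x.1 : Matrix (Fin r) (Fin r) ℝ), x.2)

/-- `(G₁, G₂)` is the Euclidean gradient of `f` at `x`:
`D f(x)[(A', B')] = tr(A'ᵀ G₁) + tr(B'ᵀ G₂)` for all `(A', B') ∈ ℝ^{r×r} × ℝ^{r×m}`. -/
def HasEuclideanGradientAt {r m : ℕ}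
    (f : Matrix (Fin r) (Fin r) ℝ × Matrix (Fin r) (Fin m) ℝ → ℝ)
    (x G : Matrix (Fin r) (Fin r) ℝ × Matrix (Fin r) (Fin m) ℝ) : Prop :=
  DifferentiableAt ℝ f x ∧
    ∀ A' B', fderiv ℝ f x (A', B') = (A'ᵀ * G.1).trace + (B'ᵀ * G.2).trace

theorem isOpen_reducedManifold (r m : ℕ) : IsOpen (reducedManifold r m) := by
  have h : reducedManifold r m = {x : TangentModel r m |
      ∀ v ∈ Metric.sphere (0 : Fin r → ℝ) 1, 0 < v ⬝ᵥ ((x.1 : Matrix (Fin r) (Fin r) ℝ) *ᵥ v)} := by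
    ext x
    constructor
    · intro hx v hv
      have hv0 : v ≠ 0 := by
        rintro rfl
        simp at hv
      simpa using (show (x.1 : Matrix (Fin r) (Fin r) ℝ).PosDef from hx).dotProduct_mulVec_pos hv0
    · intro hx
      refine Matrix.PosDef.of_dotProduct_mulVec_pos ?_ ?_
      · have : (x.1 : Matrix (Fin r) (Fin r) ℝ).IsSymm := x.1.2
        exact Matrix.isHermitian_iff_isSymm.mpr this
      · intro v hv
        have hn : 0 < ‖v‖ := norm_pos_iff.mpr hv
        have h1 := hx (‖v‖⁻¹ • v) (by simp [norm_smul, hn.ne'])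
        rw [Matrix.mulVec_smul, dotProduct_smul, smul_dotProduct, smul_eq_mul, smul_eq_mul] at h1
        have h2 : 0 < ‖v‖⁻¹ := inv_pos.mpr hn
        have h3 := pos_of_mul_pos_right h1 h2.le
        simpa using pos_of_mul_pos_right h3 h2.le
  rw [h, isOpen_iff_mem_nhds]
  intro x hx
  refine (isCompact_sphere (0 : Fin r → ℝ) 1).eventually_forall_of_forall_eventually ?_
  intro v hv
  have hc : Continuous fun z : TangentModel r m × (Fin r → ℝ) =>
      z.2 ⬝ᵥ ((z.1.1 : Matrix (Fin r) (Fin r) ℝ) *ᵥ z.2) := by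
    have h1 : Continuous fun z : TangentModel r m × (Fin r → ℝ) =>
      (z.1.1 : Matrix (Fin r) (Fin r) ℝ) := continuous_subtype_val.comp (by fun_prop)
    exact continuous_snd.dotProduct (h1.matrix_mulVec continuous_snd)
  exact (hc.tendsto (x, v)).eventually (lt_mem_nhds (hx v hv))

/-- The bilinear form `tr(S⁻¹ ξ₁ S⁻¹ ξ₂) + tr(η₁ᵀ η₂)` on `Sym(r) × ℝ^{r×m}`, `S = x.1`. -/
def affineInvariantForm (r m : ℕ) (x : TangentModel r m) :
    TangentModel r m →ₗ[ℝ] TangentModel r m →ₗ[ℝ] ℝ :=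
  LinearMap.mk₂ ℝ
    (fun v w => ((x.1 : Matrix (Fin r) (Fin r) ℝ)⁻¹ * (v.1 : Matrix (Fin r) (Fin r) ℝ) *
      (x.1 : Matrix (Fin r) (Fin r) ℝ)⁻¹ * (w.1 : Matrix (Fin r) (Fin r) ℝ)).trace +
      (v.2ᵀ * w.2).trace)
    (by intro u v w; simp [Matrix.mul_add, Matrix.add_mul]; ring)
    (by intro c u v; simp [mul_add])
    (by intro u v w; simp [Matrix.mul_add]; ring)
    (by intro c u v; simp [mul_add])

open scoped MatrixOrder Matrix.Norms.L2Operator in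
theorem exists_isUnit_transpose_mul_self {r : ℕ} {T : Matrix (Fin r) (Fin r) ℝ} (hT : T.PosDef) :
    ∃ Y : Matrix (Fin r) (Fin r) ℝ, IsUnit Y ∧ T = Yᵀ * Y := by
  obtain ⟨Y, hY, h⟩ :=
    CStarAlgebra.isStrictlyPositive_iff_eq_star_mul_self.mp hT.isStrictlyPositive
  exact ⟨Y, hY, h⟩

attribute [local instance] Matrix.frobeniusNormedRing Matrix.frobeniusNormedAlgebra in
theorem contDiffAt_matrix_inv {r : ℕ} {S : Matrix (Fin r) (Fin r) ℝ} (hS : IsUnit S) :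
    ContDiffAt ℝ ∞ (fun T : Matrix (Fin r) (Fin r) ℝ => T⁻¹) S := by
  obtain ⟨u, rfl⟩ := hS
  have : CompleteSpace (Matrix (Fin r) (Fin r) ℝ) := FiniteDimensional.complete ℝ _
  have h := contDiffAt_ringInverse ℝ (n := ∞) u
  have e : (fun T : Matrix (Fin r) (Fin r) ℝ => T⁻¹) = Ring.inverse := by
    funext T
    exact Matrix.nonsing_inv_eq_ringInverse T
  rw [e]
  exact h

theorem affineInvariantForm_pos (r m : ℕ) (x : TangentModel r m) (hx : x ∈ reducedManifold r m)
    (v : TangentModel r m) (hv : v ≠ 0) : 0 < affineInvariantForm r m x v v := by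
  have hS : (x.1 : Matrix (Fin r) (Fin r) ℝ)⁻¹.PosDef :=
    (show (x.1 : Matrix (Fin r) (Fin r) ℝ).PosDef from hx).inv
  have hξ : (v.1 : Matrix (Fin r) (Fin r) ℝ)ᵀ = v.1 := v.1.2
  obtain ⟨Y, hY, hYS⟩ := exists_isUnit_transpose_mul_self hS
  have e1 : ((x.1 : Matrix (Fin r) (Fin r) ℝ)⁻¹ * (v.1 : Matrix (Fin r) (Fin r) ℝ) *
      (x.1 : Matrix (Fin r) (Fin r) ℝ)⁻¹ * (v.1 : Matrix (Fin r) (Fin r) ℝ)).trace =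
      ((Y * (v.1 : Matrix (Fin r) (Fin r) ℝ) * Yᵀ)ᴴ *
        (Y * (v.1 : Matrix (Fin r) (Fin r) ℝ) * Yᵀ)).trace := by
    rw [hYS, Matrix.conjTranspose_eq_transpose_of_trivial]
    simp only [Matrix.transpose_mul, Matrix.transpose_transpose, hξ]
    simp only [Matrix.mul_assoc]
    rw [Matrix.trace_mul_comm]
    simp only [Matrix.mul_assoc]
  have n1 := (Matrix.posSemidef_conjTranspose_mul_self
    (Y * (v.1 : Matrix (Fin r) (Fin r) ℝ) * Yᵀ)).trace_nonneg
  have n2 := (Matrix.posSemidef_conjTranspose_mul_self v.2).trace_nonneg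
  have e2 : affineInvariantForm r m x v v =
      ((Y * (v.1 : Matrix (Fin r) (Fin r) ℝ) * Yᵀ)ᴴ *
        (Y * (v.1 : Matrix (Fin r) (Fin r) ℝ) * Yᵀ)).trace + (v.2ᴴ * v.2).trace := by
    rw [← e1, Matrix.conjTranspose_eq_transpose_of_trivial]
    rfl
  rw [e2]
  refine lt_of_le_of_ne (add_nonneg n1 n2) fun h0 => hv ?_
  have z1 := Matrix.trace_conjTranspose_mul_self_eq_zero_iff.mp
    (le_antisymm (by linarith) n1)
  have z2 := Matrix.trace_conjTranspose_mul_self_eq_zero_iff.mp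
    (le_antisymm (by linarith) n2)
  have hYt : IsUnit Yᵀ := by simpa using hY
  have z3 : (v.1 : Matrix (Fin r) (Fin r) ℝ) = 0 := by
    have h1 : Y * (v.1 : Matrix (Fin r) (Fin r) ℝ) = 0 := by
      rw [← hYt.mul_left_eq_zero]; exact z1
    rw [← hY.mul_right_eq_zero]; exact h1
  exact Prod.ext (Subtype.ext z3) z2

theorem affineInvariantForm_smooth (r m : ℕ) (v w : TangentModel r m) :
    ContDiffOn ℝ ∞ (fun x => affineInvariantForm r m x v w) (reducedManifold r m) := by
  have hval : ContDiff ℝ ∞ fun x : TangentModel r m => (x.1 : Matrix (Fin r) (Fin r) ℝ) :=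
    ((SymMat r).subtypeL.contDiff).comp contDiff_fst
  have hinv : ContDiffOn ℝ ∞
      (fun x : TangentModel r m => (x.1 : Matrix (Fin r) (Fin r) ℝ)⁻¹) (reducedManifold r m) := by
    intro x hx
    exact ((contDiffAt_matrix_inv
      (show (x.1 : Matrix (Fin r) (Fin r) ℝ).PosDef from hx).isUnit).comp x
        hval.contDiffAt).contDiffWithinAt
  have hent : ∀ i j, ContDiffOn ℝ ∞
      (fun x : TangentModel r m => (x.1 : Matrix (Fin r) (Fin r) ℝ)⁻¹ i j)
      (reducedManifold r m) := by
    intro i j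
    exact (LinearMap.toContinuousLinearMap
      (Matrix.entryLinearMap ℝ ℝ i j : Matrix (Fin r) (Fin r) ℝ →ₗ[ℝ] ℝ)).contDiff.comp_contDiffOn
        hinv
  simp only [affineInvariantForm, LinearMap.mk₂_apply, Matrix.trace, Matrix.diag, Matrix.mul_apply]
  refine ContDiffOn.add ?_ contDiffOn_const
  refine ContDiffOn.sum fun i _ => ContDiffOn.sum fun j _ => ContDiffOn.mul ?_ contDiffOn_const
  refine ContDiffOn.sum fun k _ => ContDiffOn.mul ?_ (hent _ _)
  exact ContDiffOn.sum fun l _ => ContDiffOn.mul (hent _ _) contDiffOn_const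

/-- The Riemannian metric
`⟨(ξ₁, η₁), (ξ₂, η₂)⟩_{(S, ·)} = tr(S⁻¹ ξ₁ S⁻¹ ξ₂) + tr(η₁ᵀ η₂)` on `Sym₊(r) × ℝ^{r×m}`. -/
def reducedMetric (r m : ℕ) : RiemannianMetricOn (TangentModel r m) (reducedManifold r m) where
  isOpen := isOpen_reducedManifold r m
  inner := affineInvariantForm r m
  symm := by
    intro x _ v w
    simp only [affineInvariantForm, LinearMap.mk₂_apply]
    congr 1
    · rw [Matrix.mul_assoc, Matrix.trace_mul_comm, ← Matrix.mul_assoc]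
    · rw [← Matrix.trace_transpose, Matrix.transpose_mul, Matrix.transpose_transpose]
  pos := affineInvariantForm_pos r m
  smooth := affineInvariantForm_smooth r m

end

/-! The squared `H²` norm is a combination of traces of solutions of Sylvester equations; gradient
and Hessian then come from implicit differentiation of these equations.

Near `Ar` the ambient space contains nonsymmetric matrices, so positive definiteness is replaced by
strict accretivity. This condition is open, makes `X ↦ M X + X N` invertible
(`eq_zero_of_mul_add_mul_eq_zero`), and makes `s I + M` invertible for `Re s ≥ 0`.

If `A₁ X + X A₂ = F` and `s = it`, then `(s + A₁)⁻¹ F (-s + A₂)⁻¹ = X (-s + A₂)⁻¹ + (s + A₁)⁻¹ X`.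
By Cauchy's theorem (`integral_shiftedInv_sub`) both resolvents may be replaced under the integral
by that of the identity, which leaves `2 X / (1 + t²)`, with integral `2π X`. Hence
`objectiveExt_eq`: near the given point the objective is `tr(Bᵀ S B) - 2 tr(Bᵀ X N) + tr(Nᵀ P N)`.

The derivatives `P'`, `X'` of the Gramians solve the linearized equations. At a symmetric point the
Sylvester operators are self-adjoint for the trace pairing, so pairing with the equations for `P`
and `X` eliminates `P'` and `X'` from the first derivative (`hasDirDerivAt_objectiveExt`).
Restricting to symmetric directions and undoing the two factors `Ar⁻¹` of the metric gives the
Riemannian gradient. The Hessian is the product-rule derivative of this field plus the Christoffel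
term `-sym(ξ S⁻¹ η)`. -/

/-! ### Strictly accretive matrices and the Sylvester equation -/

/-- The quadratic form of `M` is positive definite; `M` need not be symmetric. -/
def StrictlyAccretive {n : ℕ} (M : Matrix (Fin n) (Fin n) ℝ) : Prop :=
  ∀ v, v ≠ 0 → 0 < v ⬝ᵥ (M *ᵥ v)

namespace StrictlyAccretive

variable {n k : ℕ} {M : Matrix (Fin n) (Fin n) ℝ} {N : Matrix (Fin k) (Fin k) ℝ}

theorem of_posDef (h : M.PosDef) : StrictlyAccretive M := fun v hv => by
  simpa using h.dotProduct_mulVec_pos hv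

theorem transpose (h : StrictlyAccretive M) : StrictlyAccretive Mᵀ := fun v hv => by
  rw [Matrix.mulVec_transpose, dotProduct_comm, ← Matrix.dotProduct_mulVec]
  exact h v hv

theorem one : StrictlyAccretive (1 : Matrix (Fin n) (Fin n) ℝ) := of_posDef Matrix.PosDef.one

theorem nonneg (h : StrictlyAccretive M) (v : Fin n → ℝ) : 0 ≤ v ⬝ᵥ (M *ᵥ v) := by
  by_cases hv : v = 0
  · simp [hv]
  · exact (h v hv).le

theorem trace_transpose_mul_mul (M : Matrix (Fin n) (Fin n) ℝ) (X : Matrix (Fin n) (Fin k) ℝ) :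
    (Xᵀ * (M * X)).trace = ∑ j, Xᵀ j ⬝ᵥ (M *ᵥ Xᵀ j) := by
  simp only [Matrix.trace, Matrix.diag, Matrix.mul_apply, dotProduct, Matrix.mulVec,
    Matrix.transpose_apply]

theorem trace_nonneg (h : StrictlyAccretive M) (X : Matrix (Fin n) (Fin k) ℝ) :
    0 ≤ (Xᵀ * (M * X)).trace := by
  rw [trace_transpose_mul_mul]
  exact Finset.sum_nonneg fun j _ => h.nonneg _

theorem trace_pos (h : StrictlyAccretive M) {X : Matrix (Fin n) (Fin k) ℝ} (hX : X ≠ 0) :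
    0 < (Xᵀ * (M * X)).trace := by
  rw [trace_transpose_mul_mul]
  have : ∃ j, Xᵀ j ≠ 0 := by
    by_contra! hc
    exact hX (Matrix.ext fun i j => congrFun (hc j) i)
  obtain ⟨j, hj⟩ := this
  exact Finset.sum_pos' (fun j _ => h.nonneg _) ⟨j, Finset.mem_univ _, h _ hj⟩

/-- The homogeneous Sylvester equation has only the trivial solution. -/
theorem eq_zero_of_mul_add_mul_eq_zero (hM : StrictlyAccretive M) (hN : StrictlyAccretive N)
    {X : Matrix (Fin n) (Fin k) ℝ} (h : M * X + X * N = 0) : X = 0 := by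
  by_contra hX
  have h1 := hM.trace_pos hX
  have h2 := hN.transpose.trace_nonneg Xᵀ
  -- Pairing the equation with `X` gives the form of `M` summed over the columns of `X` plus the
  -- form of `N` summed over its rows; the first is positive and the second nonnegative.
  have h3 : (Xᵀ * (M * X)).trace + (Xᵀᵀ * (Nᵀ * Xᵀ)).trace = 0 := by
    have e : (Xᵀᵀ * (Nᵀ * Xᵀ)).trace = (Xᵀ * (X * N)).trace := by
      rw [← Matrix.transpose_mul, Matrix.transpose_transpose, Matrix.trace_mul_comm,
        ← Matrix.trace_transpose, Matrix.transpose_mul, Matrix.transpose_transpose]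
    rw [e, ← Matrix.trace_add, ← Matrix.mul_add, h]
    simp
  linarith

end StrictlyAccretive

section SylvesterOperator

variable {n k : ℕ}

/-- The operator `X ↦ M X + X N`, which depends linearly on `(M, N)`. -/
noncomputable def sylvesterOperator (n k : ℕ) :
    (Matrix (Fin n) (Fin n) ℝ × Matrix (Fin k) (Fin k) ℝ) →L[ℝ]
      (Matrix (Fin n) (Fin k) ℝ →L[ℝ] Matrix (Fin n) (Fin k) ℝ) :=
  LinearMap.toContinuousLinearMap
    (LinearMap.toContinuousLinearMap.toLinearMap ∘ₗ
      LinearMap.mk₂ ℝ (fun a X => a.1 * X + X * a.2)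
        (by intro a b X; simp [Matrix.mul_add, Matrix.add_mul]; abel)
        (by intro c a X; simp)
        (by intro a X Y; simp [Matrix.mul_add, Matrix.add_mul]; abel)
        (by intro c a X; simp))

/-- The solution `X` of `M X + X N = F` (if it is unique). -/
noncomputable def sylvesterSolution (M : Matrix (Fin n) (Fin n) ℝ) (N : Matrix (Fin k) (Fin k) ℝ)
    (F : Matrix (Fin n) (Fin k) ℝ) : Matrix (Fin n) (Fin k) ℝ :=
  (sylvesterOperator n k (M, N)).inverse F

variable {M : Matrix (Fin n) (Fin n) ℝ} {N : Matrix (Fin k) (Fin k) ℝ}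

/-- An injective endomorphism of a finite-dimensional space is bijective. The equivalence gives
existence of solutions, and it marks a point where operator inversion is differentiable. -/
theorem exists_equiv_sylvesterOperator (hM : StrictlyAccretive M) (hN : StrictlyAccretive N) :
    ∃ e : Matrix (Fin n) (Fin k) ℝ ≃L[ℝ] Matrix (Fin n) (Fin k) ℝ,
      (e : Matrix (Fin n) (Fin k) ℝ →L[ℝ] Matrix (Fin n) (Fin k) ℝ) =
        sylvesterOperator n k (M, N) := by
  have hinj : Function.Injective
      (sylvesterOperator n k (M, N)).toLinearMap := by
    rw [injective_iff_map_eq_zero]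
    intro X hX
    exact hM.eq_zero_of_mul_add_mul_eq_zero hN hX
  exact ⟨(LinearEquiv.ofInjectiveEndo _ hinj).toContinuousLinearEquiv, rfl⟩

theorem sylvesterSolution_spec (hM : StrictlyAccretive M) (hN : StrictlyAccretive N)
    (F : Matrix (Fin n) (Fin k) ℝ) :
    M * sylvesterSolution M N F + sylvesterSolution M N F * N = F := by
  obtain ⟨e, he⟩ := exists_equiv_sylvesterOperator hM hN
  change sylvesterOperator n k (M, N) ((sylvesterOperator n k (M, N)).inverse F) = F
  rw [← he, ContinuousLinearMap.inverse_equiv]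
  simp

theorem eq_of_sylvester_eq (hM : StrictlyAccretive M) (hN : StrictlyAccretive N)
    {X Y : Matrix (Fin n) (Fin k) ℝ} (h : M * X + X * N = M * Y + Y * N) : X = Y := by
  rw [← sub_eq_zero]
  refine hM.eq_zero_of_mul_add_mul_eq_zero hN ?_
  rw [Matrix.mul_sub, Matrix.sub_mul, ← sub_eq_zero.mpr h]
  abel

theorem existsUnique_sylvester (hM : StrictlyAccretive M) (hN : StrictlyAccretive N)
    (F : Matrix (Fin n) (Fin k) ℝ) : ∃! X : Matrix (Fin n) (Fin k) ℝ, M * X + X * N = F :=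
  ⟨sylvesterSolution M N F, sylvesterSolution_spec hM hN F, fun _ hY =>
    eq_of_sylvester_eq hM hN (hY.trans (sylvesterSolution_spec hM hN F).symm)⟩

end SylvesterOperator

/-! ### The symmetric part -/

/-- The projection `M ↦ sym(M)` of `ℝ^{r×r}` onto `Sym(r)`. -/
noncomputable def symProj (r : ℕ) : Matrix (Fin r) (Fin r) ℝ →L[ℝ] SymMat r :=
  LinearMap.toContinuousLinearMap
    { toFun := fun M => ⟨symPart M, by
        change (symPart M)ᵀ = symPart M
        simp [symPart, add_comm]⟩
      map_add' := fun M N => Subtype.ext (by simp [symPart]; module)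
      map_smul' := fun c M => Subtype.ext (by simp [symPart]; module) }

@[simp]
theorem coe_symProj {r : ℕ} (M : Matrix (Fin r) (Fin r) ℝ) :
    (symProj r M : Matrix (Fin r) (Fin r) ℝ) = symPart M := rfl

theorem symPart_of_isSymm {r : ℕ} {M : Matrix (Fin r) (Fin r) ℝ} (h : Mᵀ = M) :
    symPart M = M := by
  rw [symPart, h]; module

theorem transpose_symPart {r : ℕ} (M : Matrix (Fin r) (Fin r) ℝ) :
    (symPart M)ᵀ = symPart M := (symProj r M).2

/-- The quadratic form sees only the symmetric part, so this set is a preimage of the open set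
`reducedManifold n 0`, whose second factor is trivial. -/
theorem isOpen_strictlyAccretive (n : ℕ) :
    IsOpen {M : Matrix (Fin n) (Fin n) ℝ | StrictlyAccretive M} := by
  have h : {M : Matrix (Fin n) (Fin n) ℝ | StrictlyAccretive M} =
      (fun M => ((symProj n M, 0) : TangentModel n 0)) ⁻¹' reducedManifold n 0 := by
    ext M
    have key : ∀ v : Fin n → ℝ, v ⬝ᵥ (symPart M *ᵥ v) = v ⬝ᵥ (M *ᵥ v) := fun v => by
      have : v ⬝ᵥ (Mᵀ *ᵥ v) = v ⬝ᵥ (M *ᵥ v) := by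
        rw [Matrix.mulVec_transpose, dotProduct_comm, ← Matrix.dotProduct_mulVec]
      rw [symPart, Matrix.smul_mulVec, Matrix.add_mulVec, dotProduct_smul, dotProduct_add, this,
        smul_eq_mul]
      ring
    constructor
    · intro hM
      refine Matrix.PosDef.of_dotProduct_mulVec_pos
        (Matrix.isHermitian_iff_isSymm.mpr (symProj n M).2) fun v hv => ?_
      simpa [key] using hM v hv
    · intro hM v hv
      have := StrictlyAccretive.of_posDef (M := symPart M) hM v hv
      rwa [key] at this
  rw [h]
  exact (isOpen_reducedManifold n 0).preimage (by fun_prop)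

/-! ### Resolvents on the closed right half-plane -/

section Resolvent

attribute [local instance] Matrix.frobeniusNormedRing Matrix.frobeniusNormedAlgebra

variable {n k : ℕ}

/-- The matrix `(s I + M)⁻¹`. -/
noncomputable def shiftedInv (M : Matrix (Fin n) (Fin n) ℝ) (s : ℂ) : Matrix (Fin n) (Fin n) ℂ :=
  (s • (1 : Matrix (Fin n) (Fin n) ℂ) + M.map Complex.ofReal)⁻¹

variable {M N : Matrix (Fin n) (Fin n) ℝ}

/-- For a kernel vector `v = a + i b`, the real part of `v* (s I + M) v = 0` reads `Re s · |v|² + a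
⬝ M a + b ⬝ M b = 0`, a sum of nonnegative terms, which forces `a = b = 0`. -/
theorem StrictlyAccretive.isUnit_det (hM : StrictlyAccretive M) {s : ℂ} (hs : 0 ≤ s.re) :
    IsUnit (s • (1 : Matrix (Fin n) (Fin n) ℂ) + M.map Complex.ofReal).det := by
  rw [isUnit_iff_ne_zero]
  intro h0
  obtain ⟨v, hv, h⟩ := Matrix.exists_mulVec_eq_zero_iff.mpr h0
  set a : Fin n → ℝ := fun i => (v i).re
  set b : Fin n → ℝ := fun i => (v i).im
  have hmap : ∀ i, (M.map Complex.ofReal *ᵥ v) i = ((M *ᵥ a) i : ℂ) + (M *ᵥ b) i * Complex.I :=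
    fun i => by
      simp only [Matrix.mulVec, dotProduct, Matrix.map_apply, Complex.ofReal_sum,
        Complex.ofReal_mul, Finset.sum_mul, ← Finset.sum_add_distrib]
      refine Finset.sum_congr rfl fun j _ => ?_
      rw [mul_assoc, ← mul_add, Complex.re_add_im]
  have hre : ∀ i, s.re * a i - s.im * b i + (M *ᵥ a) i = 0 := fun i => by
    have := congrArg Complex.re (congrFun h i)
    simpa [Matrix.add_mulVec, Matrix.smul_mulVec, a, b, hmap] using this
  have him : ∀ i, s.re * b i + s.im * a i + (M *ᵥ b) i = 0 := fun i => by
    have := congrArg Complex.im (congrFun h i)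
    simpa [Matrix.add_mulVec, Matrix.smul_mulVec, a, b, hmap] using this
  have key : s.re * ∑ i, (a i ^ 2 + b i ^ 2) + a ⬝ᵥ (M *ᵥ a) + b ⬝ᵥ (M *ᵥ b) = 0 := by
    simp only [dotProduct, Finset.mul_sum, ← Finset.sum_add_distrib]
    refine Finset.sum_eq_zero fun i _ => ?_
    linear_combination a i * hre i + b i * him i
  have h1 : 0 ≤ s.re * ∑ i, (a i ^ 2 + b i ^ 2) := mul_nonneg hs (by positivity)
  have h2 := hM.nonneg a
  have h3 := hM.nonneg b
  refine hv (funext fun i => Complex.ext ?_ ?_)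
  · by_contra hc
    have := hM a (fun h => hc (congrFun h i))
    linarith
  · by_contra hc
    have := hM b (fun h => hc (congrFun h i))
    linarith

theorem StrictlyAccretive.mul_shiftedInv (hM : StrictlyAccretive M) {s : ℂ} (hs : 0 ≤ s.re) :
    (s • (1 : Matrix (Fin n) (Fin n) ℂ) + M.map Complex.ofReal) * shiftedInv M s = 1 :=
  Matrix.mul_nonsing_inv _ (hM.isUnit_det hs)

theorem StrictlyAccretive.shiftedInv_mul (hM : StrictlyAccretive M) {s : ℂ} (hs : 0 ≤ s.re) :
    shiftedInv M s * (s • (1 : Matrix (Fin n) (Fin n) ℂ) + M.map Complex.ofReal) = 1 :=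
  Matrix.nonsing_inv_mul _ (hM.isUnit_det hs)

theorem StrictlyAccretive.differentiableAt_shiftedInv (hM : StrictlyAccretive M) {s : ℂ}
    (hs : 0 ≤ s.re) : DifferentiableAt ℂ (shiftedInv M) s := by
  have : CompleteSpace (Matrix (Fin n) (Fin n) ℂ) := FiniteDimensional.complete ℂ _
  obtain ⟨u, hu⟩ := (Matrix.isUnit_iff_isUnit_det _).mpr (hM.isUnit_det hs)
  have e : shiftedInv M = fun s : ℂ =>
      Ring.inverse (s • (1 : Matrix (Fin n) (Fin n) ℂ) + M.map Complex.ofReal) := by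
    funext s
    exact Matrix.nonsing_inv_eq_ringInverse _
  rw [e]
  refine DifferentiableAt.comp s (g := Ring.inverse) ?_
    ((differentiableAt_id.smul_const _).add_const _)
  have := differentiableAt_inverse (𝕜 := ℂ) (x := (u : Matrix (Fin n) (Fin n) ℂ)) u.isUnit
  rwa [hu] at this

/-- Compactness bounds the resolvent for `‖s‖ ≤ ρ`. For larger `s`, the identity `s R = 1 - M R`
gives decay, because `‖M‖ ≤ (‖s‖ - 1) / 2` lets the last term be absorbed on the left. -/
theorem StrictlyAccretive.exists_norm_shiftedInv_le (hM : StrictlyAccretive M) :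
    ∃ K, 0 ≤ K ∧ ∀ s : ℂ, 0 ≤ s.re → ‖shiftedInv M s‖ * (1 + ‖s‖) ≤ K := by
  set Mc : Matrix (Fin n) (Fin n) ℂ := M.map Complex.ofReal with hMc
  set ρ := 2 * ‖Mc‖ + 1
  have hρ : 1 ≤ ρ := by have := norm_nonneg Mc; simp only [ρ]; linarith
  have hcomp : IsCompact ({s : ℂ | 0 ≤ s.re} ∩ Metric.closedBall 0 ρ) :=
    (isCompact_closedBall _ _).inter_left (isClosed_le continuous_const Complex.continuous_re)
  obtain ⟨K₀, hK₀⟩ := hcomp.exists_bound_of_continuousOn (f := shiftedInv M) fun s hs =>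
    (hM.differentiableAt_shiftedInv hs.1).continuousAt.continuousWithinAt
  refine ⟨max (K₀ * (1 + ρ)) (4 * ‖(1 : Matrix (Fin n) (Fin n) ℂ)‖),
    le_max_of_le_right (by positivity), fun s hs => ?_⟩
  rcases le_total ‖s‖ ρ with h | h
  · refine le_max_of_le_left ?_
    have h1 := hK₀ s ⟨hs, by simpa using h⟩
    have := norm_nonneg (shiftedInv M s)
    have := norm_nonneg s
    gcongr
    linarith
  · refine le_max_of_le_right ?_
    have h1 : s • shiftedInv M s = 1 - Mc * shiftedInv M s := by
      rw [← hM.mul_shiftedInv hs, Matrix.add_mul, Matrix.smul_mul, Matrix.one_mul, ← hMc]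
      abel
    have h2 : ‖s‖ * ‖shiftedInv M s‖ ≤
        ‖(1 : Matrix (Fin n) (Fin n) ℂ)‖ + ‖Mc‖ * ‖shiftedInv M s‖ := by
      rw [← norm_smul, h1]
      exact (norm_sub_le _ _).trans (by gcongr; exact norm_mul_le _ _)
    have h3 := norm_nonneg (shiftedInv M s)
    have h4 : 0 ≤ (‖s‖ - ρ) * ‖shiftedInv M s‖ := mul_nonneg (by linarith) h3
    have h5 : 0 ≤ (ρ - 1) * ‖shiftedInv M s‖ := mul_nonneg (by linarith) h3
    simp only [ρ] at h4 h5 hρ h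
    nlinarith

/-- The second resolvent identity. A difference of resolvents gains one order of decay over a single
one, hence is integrable on the imaginary axis and negligible on large contours. -/
theorem shiftedInv_sub_shiftedInv (hM : StrictlyAccretive M) (hN : StrictlyAccretive N) {s : ℂ}
    (hs : 0 ≤ s.re) : shiftedInv M s - shiftedInv N s =
      shiftedInv M s * (N.map Complex.ofReal - M.map Complex.ofReal) * shiftedInv N s := by
  have h : (N.map Complex.ofReal - M.map Complex.ofReal : Matrix (Fin n) (Fin n) ℂ) =
      (s • (1 : Matrix (Fin n) (Fin n) ℂ) + N.map Complex.ofReal) -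
        (s • (1 : Matrix (Fin n) (Fin n) ℂ) + M.map Complex.ofReal) := by abel
  rw [h, Matrix.mul_sub, Matrix.sub_mul, hM.shiftedInv_mul hs, Matrix.mul_assoc,
    hN.mul_shiftedInv hs, Matrix.mul_one, Matrix.one_mul]

theorem exists_norm_shiftedInv_sub_le (hM : StrictlyAccretive M) (hN : StrictlyAccretive N) :
    ∃ K, 0 ≤ K ∧ ∀ s : ℂ, 0 ≤ s.re →
      ‖shiftedInv M s - shiftedInv N s‖ * (1 + ‖s‖) ^ 2 ≤ K := by
  obtain ⟨K₁, h₁, H₁⟩ := hM.exists_norm_shiftedInv_le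
  obtain ⟨K₂, h₂, H₂⟩ := hN.exists_norm_shiftedInv_le
  set D : Matrix (Fin n) (Fin n) ℂ := N.map Complex.ofReal - M.map Complex.ofReal with hD
  refine ⟨K₁ * ‖D‖ * K₂, by positivity, fun s hs => ?_⟩
  rw [shiftedInv_sub_shiftedInv hM hN hs, ← hD]
  calc ‖shiftedInv M s * D * shiftedInv N s‖ * (1 + ‖s‖) ^ 2
      ≤ (‖shiftedInv M s‖ * ‖D‖ * ‖shiftedInv N s‖) * (1 + ‖s‖) ^ 2 := by
        gcongr
        exact (norm_mul_le _ _).trans (by gcongr; exact norm_mul_le _ _)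
    _ = (‖shiftedInv M s‖ * (1 + ‖s‖)) * ‖D‖ * (‖shiftedInv N s‖ * (1 + ‖s‖)) := by ring
    _ ≤ K₁ * ‖D‖ * K₂ := by
        have := H₁ s hs
        have := H₂ s hs
        gcongr

theorem norm_entry_le_frobenius_norm (Z : Matrix (Fin n) (Fin k) ℂ) (i : Fin n) (j : Fin k) :
    ‖Z i j‖ ≤ ‖Z‖ := by
  rw [Matrix.frobenius_norm_def, ← Real.sqrt_eq_rpow]
  refine Real.le_sqrt_of_sq_le ?_
  simp only [Real.rpow_two]
  exact (Finset.single_le_sum (f := fun j => ‖Z i j‖ ^ 2) (fun _ _ => by positivity)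
    (Finset.mem_univ j)).trans (Finset.single_le_sum (f := fun i => ∑ j, ‖Z i j‖ ^ 2)
      (fun _ _ => by positivity) (Finset.mem_univ i))

theorem StrictlyAccretive.differentiableAt_shiftedInv_entry (hM : StrictlyAccretive M) {s : ℂ}
    (hs : 0 ≤ s.re) (i j : Fin n) : DifferentiableAt ℂ (fun s => shiftedInv M s i j) s :=
  (LinearMap.toContinuousLinearMap (Matrix.entryLinearMap ℂ ℂ i j :
    Matrix (Fin n) (Fin n) ℂ →ₗ[ℂ] ℂ)).differentiableAt.comp s (hM.differentiableAt_shiftedInv hs)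

theorem StrictlyAccretive.continuous_shiftedInv_entry (hM : StrictlyAccretive M) (i j : Fin n) :
    Continuous fun t : ℝ => shiftedInv M (t * Complex.I) i j := by
  rw [continuous_iff_continuousAt]
  intro t
  exact (hM.differentiableAt_shiftedInv_entry (by simp) i j).continuousAt.comp
    (f := fun t : ℝ => (t * Complex.I : ℂ)) (by fun_prop)

theorem integrable_shiftedInv_sub (hM : StrictlyAccretive M) (hN : StrictlyAccretive N)
    (i j : Fin n) : Integrable fun t : ℝ =>
      (shiftedInv M (t * Complex.I) - shiftedInv N (t * Complex.I)) i j := by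
  obtain ⟨K, hK, H⟩ := exists_norm_shiftedInv_sub_le hM hN
  refine (integrable_inv_one_add_sq.const_mul K).mono'
    ((hM.continuous_shiftedInv_entry i j).sub
      (hN.continuous_shiftedInv_entry i j)).aestronglyMeasurable (.of_forall fun t => ?_)
  have h := H (t * Complex.I) (by simp)
  rw [← div_eq_mul_inv, le_div_iff₀ (by positivity)]
  refine le_trans ?_ h
  have : ‖(t * Complex.I : ℂ)‖ = |t| := by simp
  rw [this]
  gcongr
  · exact norm_entry_le_frobenius_norm _ i j
  have := sq_abs t
  have := abs_nonneg t
  nlinarith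

/-- By Cauchy's theorem the integrals of two resolvents along the imaginary axis agree. -/
theorem integral_shiftedInv_sub (hM : StrictlyAccretive M) (hN : StrictlyAccretive N)
    (i j : Fin n) : ∫ t : ℝ,
      (shiftedInv M (t * Complex.I) - shiftedInv N (t * Complex.I)) i j = 0 := by
  obtain ⟨K, hK, H⟩ := exists_norm_shiftedInv_sub_le hM hN
  set f : ℂ → ℂ := fun s => (shiftedInv M s - shiftedInv N s) i j with hf
  have hlim := intervalIntegral_tendsto_integral (integrable_shiftedInv_sub hM hN i j)
    Filter.tendsto_neg_atTop_atBot Filter.tendsto_id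
  refine tendsto_nhds_unique hlim ?_
  rw [tendsto_zero_iff_norm_tendsto_zero]
  refine squeeze_zero' (g := fun T : ℝ => 4 * K * T⁻¹) (.of_forall fun _ => norm_nonneg _) ?_
    (by simpa using tendsto_inv_atTop_zero.const_mul (4 * K))
  filter_upwards [Filter.eventually_gt_atTop 0] with T hT
  have hbound : ∀ s : ℂ, 0 ≤ s.re → T ≤ ‖s‖ → ‖f s‖ ≤ K / T ^ 2 := fun s hs hTs => by
    rw [le_div_iff₀ (by positivity)]
    refine le_trans ?_ (H s hs)
    gcongr
    · exact norm_entry_le_frobenius_norm _ i j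
    linarith
  -- The rectangle has corners `-iT` and `T + iT`. Its three sides off the imaginary axis have total
  -- length `4T` and satisfy `‖s‖ ≥ T`, so they contribute at most `4T · K / T²`.
  have hrect := Complex.integral_boundary_rect_eq_zero_of_differentiableOn f
    ⟨0, -T⟩ ⟨T, T⟩ (fun s hs => by
      have h0 : 0 ≤ s.re := by
        have := hs.1
        rw [Set.mem_preimage, Set.uIcc_of_le hT.le] at this
        exact this.1
      exact ((hM.differentiableAt_shiftedInv_entry h0 i j).sub
        (hN.differentiableAt_shiftedInv_entry h0 i j)).differentiableWithinAt)
  simp only [Complex.ofReal_zero, zero_add] at hrect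
  have b1 : ‖∫ x in (0 : ℝ)..T, f (x + ((-T : ℝ) : ℂ) * Complex.I)‖ ≤ K / T ^ 2 * |T - 0| := by
    refine intervalIntegral.norm_integral_le_of_norm_le_const fun x hx => ?_
    rw [Set.uIoc_of_le hT.le] at hx
    refine hbound _ (by simpa using hx.1.le) ?_
    refine le_trans ?_ (Complex.abs_im_le_norm _)
    simp [abs_of_pos hT]
  have b2 : ‖∫ x in (0 : ℝ)..T, f (x + (T : ℂ) * Complex.I)‖ ≤ K / T ^ 2 * |T - 0| := by
    refine intervalIntegral.norm_integral_le_of_norm_le_const fun x hx => ?_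
    rw [Set.uIoc_of_le hT.le] at hx
    refine hbound _ (by simpa using hx.1.le) ?_
    refine le_trans ?_ (Complex.abs_im_le_norm _)
    simp [abs_of_pos hT]
  have b3 : ‖∫ y in (-T)..T, f (T + (y : ℂ) * Complex.I)‖ ≤ K / T ^ 2 * |T - (-T)| := by
    refine intervalIntegral.norm_integral_le_of_norm_le_const fun x hx => ?_
    refine hbound _ (by simpa using hT.le) ?_
    refine le_trans ?_ (Complex.abs_re_le_norm _)
    simp [abs_of_pos hT]
  set i1 := ∫ x in (0 : ℝ)..T, f (x + ((-T : ℝ) : ℂ) * Complex.I)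
  set i2 := ∫ x in (0 : ℝ)..T, f (x + (T : ℂ) * Complex.I)
  set i3 := ∫ y in (-T)..T, f (T + (y : ℂ) * Complex.I)
  change ‖∫ t in (-T)..T, f (t * Complex.I)‖ ≤ _
  set i4 := ∫ t in (-T)..T, f (t * Complex.I)
  have e : Complex.I • i4 = i1 - i2 + Complex.I • i3 := (sub_eq_zero.mp hrect).symm
  have e4 : ‖i4‖ = ‖i1 - i2 + Complex.I • i3‖ := by rw [← e, norm_smul]; simp
  rw [e4]
  refine (norm_add_le _ _).trans ((add_le_add_left (norm_sub_le _ _) _).trans ?_)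
  rw [norm_smul, Complex.norm_I, one_mul]
  rw [sub_zero, abs_of_pos hT] at b1 b2
  rw [abs_of_pos (by linarith)] at b3
  have : 4 * K * T⁻¹ = K / T ^ 2 * T + K / T ^ 2 * T + K / T ^ 2 * (T - -T) := by
    field_simp; ring
  linarith

end Resolvent

/-! ### The `H²` norm of the error system -/

section H2Norm

variable {n k p m r : ℕ}

theorem integral_trace_mul_eq_zero {Z : ℝ → Matrix (Fin n) (Fin n) ℂ}
    (hZ : ∀ i j, Integrable fun t => Z t i j) (h0 : ∀ i j, ∫ t, Z t i j = 0)
    (W : Matrix (Fin n) (Fin n) ℂ) :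
    Integrable (fun t => (Z t * W).trace) ∧ ∫ t, (Z t * W).trace = 0 := by
  simp only [Matrix.trace, Matrix.diag, Matrix.mul_apply]
  have h : ∀ i j, Integrable fun t => Z t i j * W j i := fun i j => (hZ i j).mul_const _
  refine ⟨integrable_finsetSum _ fun i _ => integrable_finsetSum _ fun j _ => h i j, ?_⟩
  rw [integral_finsetSum _ fun i _ => integrable_finsetSum _ fun j _ => h i j]
  refine Finset.sum_eq_zero fun i _ => ?_
  rw [integral_finsetSum _ fun j _ => h i j]
  refine Finset.sum_eq_zero fun j _ => ?_
  rw [integral_mul_const, h0, zero_mul]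

theorem shiftedInv_one (s : ℂ) :
    shiftedInv (1 : Matrix (Fin n) (Fin n) ℝ) s = (s + 1)⁻¹ • (1 : Matrix (Fin n) (Fin n) ℂ) := by
  have h : s • (1 : Matrix (Fin n) (Fin n) ℂ) +
      (1 : Matrix (Fin n) (Fin n) ℝ).map Complex.ofReal = (s + 1) • 1 := by
    rw [Matrix.map_one _ Complex.ofReal_zero Complex.ofReal_one, add_smul, one_smul]
  rw [shiftedInv, h]
  -- At `s = -1` both sides vanish by the conventions for inverses.
  by_cases hs : s + 1 = 0
  · simp [hs]
  · refine Matrix.inv_eq_left_inv ?_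
    rw [smul_mul_smul_comm, inv_mul_cancel₀ hs, Matrix.one_mul, one_smul]

/-- The contribution of the two reference resolvents. Its integral over the line is `2π`, the factor
that cancels the normalization of the `H²` norm. -/
theorem inv_add_one_add_inv_neg_add_one (t : ℝ) :
    ((t * Complex.I : ℂ) + 1)⁻¹ + (-(t * Complex.I : ℂ) + 1)⁻¹ = ((2 * (1 + t ^ 2)⁻¹ : ℝ) : ℂ) := by
  have h1 : (t * Complex.I : ℂ) + 1 ≠ 0 := fun h => by simpa using congrArg Complex.re h
  have h2 : -(t * Complex.I : ℂ) + 1 ≠ 0 := fun h => by simpa using congrArg Complex.re h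
  have h3 : (1 + (t : ℂ) ^ 2) ≠ 0 := by
    have : (1 + t ^ 2 : ℝ) ≠ 0 := by positivity
    exact_mod_cast this
  push_cast
  field_simp
  linear_combination (2 * (t : ℂ) ^ 2) * Complex.I_sq

variable {A₁ : Matrix (Fin n) (Fin n) ℝ} {A₂ : Matrix (Fin k) (Fin k) ℝ}

/-- The shifts cancel in `A₁ X + X A₂ = (s + A₁) X + X (-s + A₂)`, so each resolvent removes one
factor. The two remaining terms are not separately integrable in general, hence the subtraction of
the resolvent of the identity from each. -/
theorem shiftedInv_mul_sylvester_mul_shiftedInv (h₁ : StrictlyAccretive A₁)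
    (h₂ : StrictlyAccretive A₂) (X : Matrix (Fin n) (Fin k) ℝ) (t : ℝ) :
    shiftedInv A₁ (t * Complex.I) * (A₁ * X + X * A₂).map Complex.ofReal *
        shiftedInv A₂ (-(t * Complex.I)) =
      X.map Complex.ofReal * (shiftedInv A₂ (-(t * Complex.I)) - shiftedInv 1 (-(t * Complex.I))) +
      (shiftedInv A₁ (t * Complex.I) - shiftedInv 1 (t * Complex.I)) * X.map Complex.ofReal +
      ((2 * (1 + t ^ 2)⁻¹ : ℝ) : ℂ) • X.map Complex.ofReal := by
  set s : ℂ := t * Complex.I with hs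
  have e : (A₁ * X + X * A₂).map Complex.ofReal =
      (s • (1 : Matrix (Fin n) (Fin n) ℂ) + A₁.map Complex.ofReal) * X.map Complex.ofReal +
      X.map Complex.ofReal * ((-s) • (1 : Matrix (Fin k) (Fin k) ℂ) + A₂.map Complex.ofReal) := by
    have e1 : (A₁ * X + X * A₂).map Complex.ofReal = A₁.map Complex.ofReal * X.map Complex.ofReal +
        X.map Complex.ofReal * A₂.map Complex.ofReal := by
      rw [Matrix.map_add _ Complex.ofReal_add]
      congr 1 <;> exact Matrix.map_mul (f := Complex.ofRealHom)
    rw [e1]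
    simp only [Matrix.add_mul, Matrix.mul_add, Matrix.smul_mul, Matrix.mul_smul, Matrix.one_mul,
      Matrix.mul_one, neg_smul, Matrix.mul_neg]
    abel
  rw [e, Matrix.mul_add, Matrix.add_mul, ← Matrix.mul_assoc, h₁.shiftedInv_mul (by simp [s]),
    Matrix.one_mul, Matrix.mul_assoc, Matrix.mul_assoc, h₂.mul_shiftedInv (by simp [s]),
    Matrix.mul_one, ← inv_add_one_add_inv_neg_add_one, shiftedInv_one, shiftedInv_one, ← hs]
  simp only [Matrix.mul_sub, Matrix.sub_mul, Matrix.smul_mul, Matrix.mul_smul, Matrix.one_mul,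
    Matrix.mul_one, add_smul]
  abel

/-- The integral `∫ U (it + A₁)⁻¹ F (-it + A₂)⁻¹ V dt` is given by the solution of the Sylvester
equation `A₁ X + X A₂ = F`. -/
theorem integral_trace_shiftedInv_mul (h₁ : StrictlyAccretive A₁) (h₂ : StrictlyAccretive A₂)
    (X : Matrix (Fin n) (Fin k) ℝ) (U : Matrix (Fin p) (Fin n) ℂ) (V : Matrix (Fin k) (Fin p) ℂ) :
    Integrable (fun t : ℝ => (U * (shiftedInv A₁ (t * Complex.I) *
      (A₁ * X + X * A₂).map Complex.ofReal * shiftedInv A₂ (-(t * Complex.I))) * V).trace) ∧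
    ∫ t : ℝ, (U * (shiftedInv A₁ (t * Complex.I) *
      (A₁ * X + X * A₂).map Complex.ofReal * shiftedInv A₂ (-(t * Complex.I))) * V).trace =
      2 * Real.pi * (U * X.map Complex.ofReal * V).trace := by
  have e : ∀ t : ℝ, (U * (shiftedInv A₁ (t * Complex.I) *
      (A₁ * X + X * A₂).map Complex.ofReal * shiftedInv A₂ (-(t * Complex.I))) * V).trace =
      ((shiftedInv A₂ (((-t : ℝ) : ℂ) * Complex.I) - shiftedInv 1 (((-t : ℝ) : ℂ) * Complex.I)) *
        (V * (U * X.map Complex.ofReal))).trace +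
      ((shiftedInv A₁ (t * Complex.I) - shiftedInv 1 (t * Complex.I)) *
        (X.map Complex.ofReal * V * U)).trace +
      ((2 * (1 + t ^ 2)⁻¹ : ℝ) : ℂ) * (U * X.map Complex.ofReal * V).trace := fun t => by
    rw [shiftedInv_mul_sylvester_mul_shiftedInv h₁ h₂, Matrix.mul_add, Matrix.mul_add,
      Matrix.add_mul, Matrix.add_mul, Matrix.trace_add, Matrix.trace_add, Matrix.mul_smul,
      Matrix.smul_mul, Matrix.trace_smul, smul_eq_mul, Complex.ofReal_neg, neg_mul]
    congr 2
    · rw [← Matrix.mul_assoc, Matrix.trace_mul_comm, ← Matrix.mul_assoc, Matrix.trace_mul_comm]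
    · rw [Matrix.mul_assoc, Matrix.trace_mul_comm]
      simp only [Matrix.mul_assoc]
  -- The resolvents of `A₂` occur at `-it`; the reflection `t ↦ -t` reduces them to the case already
  -- treated.
  obtain ⟨i1, j1⟩ := integral_trace_mul_eq_zero
    (fun i j => (integrable_shiftedInv_sub h₂ .one i j).comp_neg)
    (fun i j => (integral_neg_eq_self (fun t : ℝ => (shiftedInv A₂ (t * Complex.I) -
      shiftedInv (1 : Matrix (Fin k) (Fin k) ℝ) (t * Complex.I)) i j) volume).trans
        (integral_shiftedInv_sub h₂ .one i j)) (V * (U * X.map Complex.ofReal))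
  obtain ⟨i2, j2⟩ := integral_trace_mul_eq_zero (integrable_shiftedInv_sub h₁ .one)
    (integral_shiftedInv_sub h₁ .one) (X.map Complex.ofReal * V * U)
  have i3 : Integrable fun t : ℝ =>
      ((2 * (1 + t ^ 2)⁻¹ : ℝ) : ℂ) * (U * X.map Complex.ofReal * V).trace :=
    (integrable_inv_one_add_sq.const_mul 2).ofReal.mul_const _
  simp only [e]
  refine ⟨(i1.add i2).add i3, ?_⟩
  refine (integral_add (i1.add i2) i3).trans
    ((congrArg (· + _) (integral_add i1 i2)).trans ?_)
  rw [j1, j2, integral_mul_const, integral_complex_ofReal, integral_const_mul, integral_univ_inv_one_add_sq]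
  simp

theorem conjTranspose_map_ofReal (M : Matrix (Fin n) (Fin k) ℝ) :
    (M.map Complex.ofReal)ᴴ = Mᵀ.map Complex.ofReal := by
  ext i j; simp

/-- Conjugation sends `it` to `-it`. This is why the adjoint in the `H²` inner product produces the
second resolvent at `-it`, with the transposed matrix. -/
theorem conjTranspose_shiftedInv (M : Matrix (Fin n) (Fin n) ℝ) (t : ℝ) :
    (shiftedInv M (t * Complex.I))ᴴ = shiftedInv Mᵀ (-(t * Complex.I)) := by
  rw [shiftedInv, shiftedInv, Matrix.conjTranspose_nonsing_inv, Matrix.conjTranspose_add,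
    conjTranspose_map_ofReal, Matrix.conjTranspose_smul]
  simp

/-- The `H²` inner product of two transfer functions. -/
theorem integral_trace_transferFunction_mul_conjTranspose (h₁ : StrictlyAccretive A₁)
    (h₂ : StrictlyAccretive A₂) {B₁ : Matrix (Fin n) (Fin m) ℝ} {B₂ : Matrix (Fin k) (Fin m) ℝ}
    (C₁ : Matrix (Fin p) (Fin n) ℝ) (C₂ : Matrix (Fin p) (Fin k) ℝ)
    {X : Matrix (Fin n) (Fin k) ℝ} (hX : A₁ * X + X * A₂ᵀ = B₁ * B₂ᵀ) :
    Integrable (fun t : ℝ => (transferFunction A₁ B₁ C₁ (Complex.I * t) *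
      (transferFunction A₂ B₂ C₂ (Complex.I * t))ᴴ).trace) ∧
    ∫ t : ℝ, (transferFunction A₁ B₁ C₁ (Complex.I * t) *
      (transferFunction A₂ B₂ C₂ (Complex.I * t))ᴴ).trace =
      ((2 * Real.pi * (C₁ * X * C₂ᵀ).trace : ℝ) : ℂ) := by
  have e : ∀ t : ℝ, (transferFunction A₁ B₁ C₁ (Complex.I * t) *
      (transferFunction A₂ B₂ C₂ (Complex.I * t))ᴴ) = C₁.map Complex.ofReal *
      (shiftedInv A₁ (t * Complex.I) * (A₁ * X + X * A₂ᵀ).map Complex.ofReal *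
        shiftedInv A₂ᵀ (-(t * Complex.I))) * C₂ᵀ.map Complex.ofReal := fun t => by
    have e1 : (B₁ * B₂ᵀ).map Complex.ofReal = B₁.map Complex.ofReal * B₂ᵀ.map Complex.ofReal :=
      Matrix.map_mul (f := Complex.ofRealHom)
    change (C₁.map Complex.ofReal * shiftedInv A₁ (Complex.I * t) * B₁.map Complex.ofReal) *
      (C₂.map Complex.ofReal * shiftedInv A₂ (Complex.I * t) * B₂.map Complex.ofReal)ᴴ = _
    rw [hX, e1, mul_comm Complex.I, Matrix.conjTranspose_mul, Matrix.conjTranspose_mul,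
      conjTranspose_map_ofReal, conjTranspose_map_ofReal, conjTranspose_shiftedInv]
    simp only [Matrix.mul_assoc]
  simp only [e]
  obtain ⟨h, h'⟩ := integral_trace_shiftedInv_mul h₁ h₂.transpose X (C₁.map Complex.ofReal)
    (C₂ᵀ.map Complex.ofReal)
  refine ⟨h, h'.trans ?_⟩
  have e2 : C₁.map Complex.ofReal * X.map Complex.ofReal * C₂ᵀ.map Complex.ofReal =
      (C₁ * X * C₂ᵀ).map Complex.ofReal := by
    have := Matrix.map_mul (f := Complex.ofRealHom) (L := C₁ * X) (M := C₂ᵀ)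
    have h' := Matrix.map_mul (f := Complex.ofRealHom) (L := C₁) (M := X)
    exact ((this.trans (congrArg (· * _) h'))).symm
  rw [e2]
  push_cast
  congr 1
  simp [Matrix.trace]

theorem ofReal_frobeniusSq (G : Matrix (Fin p) (Fin m) ℂ) :
    (frobeniusSq G : ℂ) = (G * Gᴴ).trace := by
  simp only [frobeniusSq, Matrix.trace, Matrix.diag, Matrix.mul_apply, Matrix.conjTranspose_apply]
  push_cast
  refine Finset.sum_congr rfl fun i _ => Finset.sum_congr rfl fun j _ => ?_
  rw [← Complex.mul_conj']
  rfl

theorem frobeniusSq_nonneg (G : Matrix (Fin p) (Fin m) ℂ) : 0 ≤ frobeniusSq G :=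
  Finset.sum_nonneg fun _ _ => Finset.sum_nonneg fun _ _ => by positivity

variable {A : Matrix (Fin n) (Fin n) ℝ} {B : Matrix (Fin n) (Fin m) ℝ}
  {M : Matrix (Fin r) (Fin r) ℝ} {N : Matrix (Fin r) (Fin m) ℝ}

/-- Polarization: the squared norm of the difference is a sum of four inner products, each given by
a Sylvester solution. Transposition turns the equation of one mixed term into that of the other, so
the mixed terms agree. -/
theorem integral_frobeniusSq_gradientErrorSystem (hA : StrictlyAccretive A)
    (hM : StrictlyAccretive M) {S : Matrix (Fin n) (Fin n) ℝ} {X : Matrix (Fin n) (Fin r) ℝ}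
    {P : Matrix (Fin r) (Fin r) ℝ} (hS : A * S + S * Aᵀ = B * Bᵀ)
    (hX : A * X + X * Mᵀ = B * Nᵀ) (hP : M * P + P * Mᵀ = N * Nᵀ) :
    HasFiniteH2Norm (gradientErrorSystem A B M N) ∧
    ∫ t : ℝ, frobeniusSq (gradientErrorSystem A B M N (Complex.I * t)) =
      2 * Real.pi * ((Bᵀ * S * B).trace - 2 * (Bᵀ * X * N).trace + (Nᵀ * P * N).trace) := by
  have hX' : M * Xᵀ + Xᵀ * Aᵀ = N * Bᵀ := by
    have := congrArg Matrix.transpose hX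
    simp only [Matrix.transpose_add, Matrix.transpose_mul, Matrix.transpose_transpose] at this
    rw [add_comm, this]
  obtain ⟨i1, j1⟩ := integral_trace_transferFunction_mul_conjTranspose hA hA Bᵀ Bᵀ hS
  obtain ⟨i2, j2⟩ := integral_trace_transferFunction_mul_conjTranspose hA hM Bᵀ Nᵀ hX
  obtain ⟨i3, j3⟩ := integral_trace_transferFunction_mul_conjTranspose hM hA Nᵀ Bᵀ hX'
  obtain ⟨i4, j4⟩ := integral_trace_transferFunction_mul_conjTranspose hM hM Nᵀ Nᵀ hP
  have e : ∀ t : ℝ, (frobeniusSq (gradientErrorSystem A B M N (Complex.I * t)) : ℂ) =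
      ((transferFunction A B Bᵀ (Complex.I * t) *
        (transferFunction A B Bᵀ (Complex.I * t))ᴴ).trace -
      (transferFunction A B Bᵀ (Complex.I * t) *
        (transferFunction M N Nᵀ (Complex.I * t))ᴴ).trace) -
      ((transferFunction M N Nᵀ (Complex.I * t) *
        (transferFunction A B Bᵀ (Complex.I * t))ᴴ).trace -
      (transferFunction M N Nᵀ (Complex.I * t) *
        (transferFunction M N Nᵀ (Complex.I * t))ᴴ).trace) := fun t => by
    rw [ofReal_frobeniusSq, gradientErrorSystem, Matrix.conjTranspose_sub, Matrix.sub_mul,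
      Matrix.mul_sub, Matrix.mul_sub, Matrix.trace_sub, Matrix.trace_sub, Matrix.trace_sub]
  have hint : Integrable fun t : ℝ =>
      (frobeniusSq (gradientErrorSystem A B M N (Complex.I * t)) : ℂ) := by
    simp only [e]
    exact (i1.sub i2).sub (i3.sub i4)
  refine ⟨by simpa [HasFiniteH2Norm] using hint.re, ?_⟩
  rw [← Complex.ofReal_inj, ← integral_complex_ofReal]
  simp only [e]
  refine (integral_sub (i1.sub i2) (i3.sub i4)).trans ((congrArg₂ (· - ·) (integral_sub i1 i2)
    (integral_sub i3 i4)).trans ?_)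
  rw [j1, j2, j3, j4]
  have t1 : (Nᵀ * Xᵀ * Bᵀᵀ).trace = (Bᵀ * X * N).trace := by
    rw [← Matrix.trace_transpose]
    simp [Matrix.mul_assoc]
  rw [t1]
  simp only [Matrix.transpose_transpose]
  push_cast
  ring

/-- Symmetry of `M` is not assumed: the formula has to hold on a full neighbourhood in the ambient
space before it can be differentiated. -/
theorem objectiveExt_eq (hA : StrictlyAccretive A)
    (hM : StrictlyAccretive M) {S : Matrix (Fin n) (Fin n) ℝ} {X : Matrix (Fin n) (Fin r) ℝ}
    {P : Matrix (Fin r) (Fin r) ℝ} (hS : A * S + S * Aᵀ = B * Bᵀ)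
    (hX : A * X + X * Mᵀ = B * Nᵀ) (hP : M * P + P * Mᵀ = N * Nᵀ) :
    objectiveExt A B (M, N) =
      (Bᵀ * S * B).trace - 2 * (Bᵀ * X * N).trace + (Nᵀ * P * N).trace := by
  rw [objectiveExt, h2Norm, Real.sq_sqrt (mul_nonneg (by positivity)
    (integral_nonneg fun t => frobeniusSq_nonneg _)),
    (integral_frobeniusSq_gradientErrorSystem hA hM hS hX hP).2]
  field_simp

end H2Norm

/-! ### Directional derivatives of differentiable matrix-valued maps -/

/-- `f` is Fréchet differentiable at `x`, and `v` is its derivative in the direction `h`. -/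
def HasDirDerivAt {E F : Type*} [NormedAddCommGroup E] [NormedSpace ℝ E]
    [NormedAddCommGroup F] [NormedSpace ℝ F] (f : E → F) (x h : E) (v : F) : Prop :=
  DifferentiableAt ℝ f x ∧ fderiv ℝ f x h = v

/-- Matrix multiplication as a continuous bilinear map. -/
noncomputable def matrixMulBilin (a b c : ℕ) :
    Matrix (Fin a) (Fin b) ℝ →L[ℝ] Matrix (Fin b) (Fin c) ℝ →L[ℝ] Matrix (Fin a) (Fin c) ℝ :=
  LinearMap.toContinuousLinearMap
    (LinearMap.toContinuousLinearMap.toLinearMap ∘ₗ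
      LinearMap.mk₂ ℝ (fun M N => M * N) Matrix.add_mul (fun c M N => Matrix.smul_mul c M N)
        Matrix.mul_add (fun c M N => Matrix.mul_smul M c N))

namespace HasDirDerivAt

variable {E F G : Type*} [NormedAddCommGroup E] [NormedSpace ℝ E]
  [NormedAddCommGroup F] [NormedSpace ℝ F] [NormedAddCommGroup G] [NormedSpace ℝ G]
  {f g : E → F} {x h : E} {v w : F}

theorem of_hasFDerivAt {f' : E →L[ℝ] F} (hf : HasFDerivAt f f' x) :
    HasDirDerivAt f x h (f' h) := ⟨hf.differentiableAt, by rw [hf.fderiv]⟩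

theorem of_differentiableAt (hf : DifferentiableAt ℝ f x) :
    HasDirDerivAt f x h (fderiv ℝ f x h) := ⟨hf, rfl⟩

theorem unique (hv : HasDirDerivAt f x h v) (hw : HasDirDerivAt f x h w) : v = w :=
  hv.2.symm.trans hw.2

theorem congr_of_eventuallyEq (hf : HasDirDerivAt f x h v) (e : g =ᶠ[nhds x] f) :
    HasDirDerivAt g x h v :=
  ⟨hf.1.congr_of_eventuallyEq e, by rw [e.fderiv_eq, hf.2]⟩

theorem const (c : F) : HasDirDerivAt (fun _ : E => c) x h 0 := ⟨by fun_prop, by simp⟩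

theorem add (hf : HasDirDerivAt f x h v) (hg : HasDirDerivAt g x h w) :
    HasDirDerivAt (fun y => f y + g y) x h (v + w) :=
  ⟨hf.1.add hg.1, by rw [fderiv_fun_add hf.1 hg.1, ← hf.2, ← hg.2]; rfl⟩

theorem sub (hf : HasDirDerivAt f x h v) (hg : HasDirDerivAt g x h w) :
    HasDirDerivAt (fun y => f y - g y) x h (v - w) :=
  ⟨hf.1.sub hg.1, by rw [fderiv_fun_sub hf.1 hg.1, ← hf.2, ← hg.2]; rfl⟩

theorem clm (hf : HasDirDerivAt f x h v) (L : F →L[ℝ] G) :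
    HasDirDerivAt (fun y => L (f y)) x h (L v) := by
  have := of_hasFDerivAt (h := h) (L.hasFDerivAt.comp x hf.1.hasFDerivAt)
  rw [ContinuousLinearMap.comp_apply, hf.2] at this
  exact this

theorem linear [FiniteDimensional ℝ F] (hf : HasDirDerivAt f x h v) (L : F →ₗ[ℝ] G) :
    HasDirDerivAt (fun y => L (f y)) x h (L v) := hf.clm (LinearMap.toContinuousLinearMap L)

theorem const_smul (hf : HasDirDerivAt f x h v) (c : ℝ) :
    HasDirDerivAt (fun y => c • f y) x h (c • v) := hf.clm (c • ContinuousLinearMap.id ℝ F)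

theorem prodMk {g : E → G} {w : G} (hf : HasDirDerivAt f x h v) (hg : HasDirDerivAt g x h w) :
    HasDirDerivAt (fun y => (f y, g y)) x h (v, w) :=
  ⟨hf.1.prodMk hg.1, by rw [hf.1.fderiv_prodMk hg.1, ← hf.2, ← hg.2]; rfl⟩

theorem comp_clm {L : G →L[ℝ] E} {z k : G} (hf : HasDirDerivAt f (L z) (L k) v) :
    HasDirDerivAt (fun y => f (L y)) z k v := by
  have := of_hasFDerivAt (h := k) (hf.1.hasFDerivAt.comp z L.hasFDerivAt)
  rw [ContinuousLinearMap.comp_apply, hf.2] at this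
  exact this

theorem bilinear {V : Type*} [NormedAddCommGroup V] [NormedSpace ℝ V]
    (L : F →L[ℝ] G →L[ℝ] V) (hf : HasDirDerivAt f x h v) {g : E → G} {w : G}
    (hg : HasDirDerivAt g x h w) :
    HasDirDerivAt (fun y => L (f y) (g y)) x h (L v (g x) + L (f x) w) := by
  have := of_hasFDerivAt (h := h)
    (L.hasFDerivAt_of_bilinear hf.1.hasFDerivAt hg.1.hasFDerivAt)
  simpa [hf.2, hg.2, add_comm] using this

theorem differentiableAt_inverse_apply {V W : Type*} [NormedAddCommGroup V] [NormedSpace ℝ V]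
    [CompleteSpace V] [NormedAddCommGroup W] [NormedSpace ℝ W] (L : F →L[ℝ] V →L[ℝ] W) {k : E → W}
    (e : V ≃L[ℝ] W) (he : (e : V →L[ℝ] W) = L (f x)) (hf : DifferentiableAt ℝ f x)
    (hk : DifferentiableAt ℝ k x) :
    DifferentiableAt ℝ (fun y => (L (f y)).inverse (k y)) x := by
  have h1 : DifferentiableAt ℝ (ContinuousLinearMap.inverse : (V →L[ℝ] W) → W →L[ℝ] V)
      (L (f x)) := by
    rw [← he]
    exact (contDiffAt_map_inverse (n := 1) e).differentiableAt one_ne_zero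
  exact (h1.comp x (L.differentiableAt.comp x hf)).clm_apply hk

theorem ring_inverse {R : Type*} [NormedRing R] [NormedAlgebra ℝ R] [CompleteSpace R] {f : E → R}
    {v : R} (hf : HasDirDerivAt f x h v) (u : Rˣ) (hu : ↑u = f x) :
    HasDirDerivAt (fun y => Ring.inverse (f y)) x h (-(↑u⁻¹ * v * ↑u⁻¹)) := by
  have h1 := hasFDerivAt_ringInverse (𝕜 := ℝ) u
  rw [hu] at h1
  have h2 := of_hasFDerivAt (h := h) (h1.comp x hf.1.hasFDerivAt)
  rw [ContinuousLinearMap.comp_apply, hf.2] at h2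
  exact h2

variable {a b c : ℕ}

theorem matrix_mul {M : E → Matrix (Fin a) (Fin b) ℝ} {N : E → Matrix (Fin b) (Fin c) ℝ}
    {M' : Matrix (Fin a) (Fin b) ℝ} {N' : Matrix (Fin b) (Fin c) ℝ}
    (hM : HasDirDerivAt M x h M') (hN : HasDirDerivAt N x h N') :
    HasDirDerivAt (fun y => M y * N y) x h (M' * N x + M x * N') :=
  hM.bilinear (matrixMulBilin a b c) hN

theorem matrix_transpose {M : E → Matrix (Fin a) (Fin b) ℝ} {M' : Matrix (Fin a) (Fin b) ℝ}
    (hM : HasDirDerivAt M x h M') : HasDirDerivAt (fun y => (M y)ᵀ) x h M'ᵀ :=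
  hM.linear (Matrix.transposeLinearEquiv (Fin a) (Fin b) ℝ ℝ).toLinearMap

theorem matrix_trace {M : E → Matrix (Fin a) (Fin a) ℝ} {M' : Matrix (Fin a) (Fin a) ℝ}
    (hM : HasDirDerivAt M x h M') : HasDirDerivAt (fun y => (M y).trace) x h M'.trace :=
  hM.linear (Matrix.traceLinearMap (Fin a) ℝ ℝ)

attribute [local instance] Matrix.frobeniusNormedRing Matrix.frobeniusNormedAlgebra in
theorem matrix_inv {M : E → Matrix (Fin a) (Fin a) ℝ} {M' : Matrix (Fin a) (Fin a) ℝ}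
    (hM : HasDirDerivAt M x h M') (hu : IsUnit (M x)) :
    HasDirDerivAt (fun y => (M y)⁻¹) x h (-((M x)⁻¹ * M' * (M x)⁻¹)) := by
  have : CompleteSpace (Matrix (Fin a) (Fin a) ℝ) := FiniteDimensional.complete ℝ _
  obtain ⟨u, hu⟩ := hu
  have e : (fun y => (M y)⁻¹) = fun y => Ring.inverse (M y) := by
    funext y
    exact Matrix.nonsing_inv_eq_ringInverse _
  have h3 : (M x)⁻¹ = ((u⁻¹ : (Matrix (Fin a) (Fin a) ℝ)ˣ) : Matrix (Fin a) (Fin a) ℝ) := by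
    rw [Matrix.nonsing_inv_eq_ringInverse, ← hu, Ring.inverse_unit]
  rw [e, h3]
  exact hM.ring_inverse u hu

/-- Implicit differentiation. Differentiability comes from that of operator inversion; the
derivative then solves the linearized equation, whose solution is unique. -/
theorem sylvesterSolution {M : E → Matrix (Fin a) (Fin a) ℝ} {N : E → Matrix (Fin b) (Fin b) ℝ}
    {F : E → Matrix (Fin a) (Fin b) ℝ} {M' : Matrix (Fin a) (Fin a) ℝ}
    {N' : Matrix (Fin b) (Fin b) ℝ} {F' X' : Matrix (Fin a) (Fin b) ℝ}
    (hM : HasDirDerivAt M x h M') (hN : HasDirDerivAt N x h N') (hF : HasDirDerivAt F x h F')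
    (aM : StrictlyAccretive (M x)) (aN : StrictlyAccretive (N x))
    (hX' : M' * sylvesterSolution (M x) (N x) (F x) + M x * X' +
      (X' * N x + sylvesterSolution (M x) (N x) (F x) * N') = F') :
    HasDirDerivAt (fun y => sylvesterSolution (M y) (N y) (F y)) x h X' := by
  have : CompleteSpace (Matrix (Fin a) (Fin b) ℝ) := FiniteDimensional.complete ℝ _
  have hd : DifferentiableAt ℝ (fun y => _root_.sylvesterSolution (M y) (N y) (F y)) x := by
    obtain ⟨e, he⟩ := exists_equiv_sylvesterOperator aM aN
    exact differentiableAt_inverse_apply (sylvesterOperator a b) e he (hM.1.prodMk hN.1) hF.1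
  have hX := of_differentiableAt (h := h) hd
  -- Differentiating the equation requires it near `x`, which openness of accretivity provides.
  have hev : (fun y => M y * _root_.sylvesterSolution (M y) (N y) (F y) +
      _root_.sylvesterSolution (M y) (N y) (F y) * N y) =ᶠ[nhds x] F := by
    filter_upwards [hM.1.continuousAt.eventually ((isOpen_strictlyAccretive a).mem_nhds aM),
      hN.1.continuousAt.eventually ((isOpen_strictlyAccretive b).mem_nhds aN)] with y h1 h2
    exact sylvesterSolution_spec h1 h2 (F y)
  have key := ((hM.matrix_mul hX).add (hX.matrix_mul hN)).unique (hF.congr_of_eventuallyEq hev)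
  refine ⟨hd, eq_of_sylvester_eq aM aN ?_⟩
  rw [← hX'] at key
  rw [← sub_eq_zero] at key ⊢
  rw [← key]
  abel

end HasDirDerivAt

/-! ### The Euclidean gradient -/

section Gradient

variable {n m r : ℕ}

/-- The controllability Gramian of the system `(-M, N)`, where `x = (M, N)`. -/
noncomputable def reducedGramian (x : Matrix (Fin r) (Fin r) ℝ × Matrix (Fin r) (Fin m) ℝ) :
    Matrix (Fin r) (Fin r) ℝ :=
  sylvesterSolution x.1 x.1ᵀ (x.2 * x.2ᵀ)

/-- The mixed Gramian of the systems `(-A, B)` and `(-M, N)`, where `x = (M, N)`. -/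
noncomputable def crossGramian (A : Matrix (Fin n) (Fin n) ℝ) (B : Matrix (Fin n) (Fin m) ℝ)
    (x : Matrix (Fin r) (Fin r) ℝ × Matrix (Fin r) (Fin m) ℝ) : Matrix (Fin n) (Fin r) ℝ :=
  sylvesterSolution A x.1ᵀ (B * x.2ᵀ)

variable {A : Matrix (Fin n) (Fin n) ℝ} {B : Matrix (Fin n) (Fin m) ℝ}
  {M M' : Matrix (Fin r) (Fin r) ℝ} {N N' : Matrix (Fin r) (Fin m) ℝ}

theorem hasDirDerivAt_fst {E F : Type*} [NormedAddCommGroup E] [NormedSpace ℝ E]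
    [NormedAddCommGroup F] [NormedSpace ℝ F] (x h : E × F) :
    HasDirDerivAt (Prod.fst : E × F → E) x h h.1 :=
  HasDirDerivAt.of_hasFDerivAt (f' := ContinuousLinearMap.fst ℝ E F) hasFDerivAt_fst

theorem hasDirDerivAt_snd {E F : Type*} [NormedAddCommGroup E] [NormedSpace ℝ E]
    [NormedAddCommGroup F] [NormedSpace ℝ F] (x h : E × F) :
    HasDirDerivAt (Prod.snd : E × F → F) x h h.2 :=
  HasDirDerivAt.of_hasFDerivAt (f' := ContinuousLinearMap.snd ℝ E F) hasFDerivAt_snd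

theorem hasDirDerivAt_reducedGramian (hM : StrictlyAccretive M) {P' : Matrix (Fin r) (Fin r) ℝ}
    (h : M' * reducedGramian (M, N) + M * P' + (P' * Mᵀ + reducedGramian (M, N) * M'ᵀ) =
      N' * Nᵀ + N * N'ᵀ) :
    HasDirDerivAt reducedGramian (M, N) (M', N') P' :=
  have h1 := hasDirDerivAt_fst (M, N) (M', N')
  have h2 := hasDirDerivAt_snd (M, N) (M', N')
  h1.sylvesterSolution h1.matrix_transpose (h2.matrix_mul h2.matrix_transpose) hM hM.transpose h

theorem hasDirDerivAt_crossGramian (hA : StrictlyAccretive A) (hM : StrictlyAccretive M)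
    {X' : Matrix (Fin n) (Fin r) ℝ}
    (h : A * X' + (X' * Mᵀ + crossGramian A B (M, N) * M'ᵀ) = B * N'ᵀ) :
    HasDirDerivAt (crossGramian A B) (M, N) (M', N') X' :=
  have h1 := hasDirDerivAt_fst (M, N) (M', N')
  have h2 := hasDirDerivAt_snd (M, N) (M', N')
  (HasDirDerivAt.const A).sylvesterSolution h1.matrix_transpose
    ((HasDirDerivAt.const B).matrix_mul h2.matrix_transpose) hA hM.transpose
    (by simpa [crossGramian] using h)

/-- Transposition exchanges the two terms on the left and fixes `N Nᵀ`, so uniqueness applies. -/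
theorem transpose_reducedGramian (hM : StrictlyAccretive M) :
    (reducedGramian (M, N))ᵀ = reducedGramian (M, N) := by
  have h := sylvesterSolution_spec hM hM.transpose (N * Nᵀ)
  refine eq_of_sylvester_eq hM hM.transpose (Eq.trans ?_ h.symm)
  have := congrArg Matrix.transpose h
  simpa [reducedGramian, add_comm] using this

theorem objectiveExt_eq_gramians (hA : StrictlyAccretive A) (hM : StrictlyAccretive M) :
    objectiveExt A B (M, N) = (Bᵀ * sylvesterSolution A Aᵀ (B * Bᵀ) * B).trace -
      (2 : ℝ) • (Bᵀ * crossGramian A B (M, N) * N).trace +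
        (Nᵀ * reducedGramian (M, N) * N).trace :=
  objectiveExt_eq hA hM (sylvesterSolution_spec hA hA.transpose _)
    (sylvesterSolution_spec hA hM.transpose _) (sylvesterSolution_spec hM hM.transpose _)

/-- The product rule leaves traces containing `P'` and `X'`. These are removed by an adjoint
argument, which uses the symmetry of `A` and `M`; the direction `(M', N')` stays arbitrary. -/
theorem hasDirDerivAt_objectiveExt (hA : StrictlyAccretive A) (hAs : Aᵀ = A)
    (hM : StrictlyAccretive M) (hMs : Mᵀ = M)
    {P : Matrix (Fin r) (Fin r) ℝ} {X : Matrix (Fin n) (Fin r) ℝ}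
    (hP : P = reducedGramian (M, N)) (hX : X = crossGramian A B (M, N)) :
    HasDirDerivAt (objectiveExt A B) (M, N) (M', N')
      ((M'ᵀ * ((-2 : ℝ) • (P ^ 2 - Xᵀ * X))).trace +
        (N'ᵀ * ((4 : ℝ) • (P * N) - (4 : ℝ) • (Xᵀ * B))).trace) := by
  have hPt : Pᵀ = P := by rw [hP]; exact transpose_reducedGramian hM
  have eP : M * P + P * Mᵀ = N * Nᵀ := by rw [hP]; exact sylvesterSolution_spec hM hM.transpose _
  have eX : A * X + X * Mᵀ = B * Nᵀ := by rw [hX]; exact sylvesterSolution_spec hA hM.transpose _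
  obtain ⟨P', hP', -⟩ := existsUnique_sylvester hM hM.transpose
    (N' * Nᵀ + N * N'ᵀ - M' * P - P * M'ᵀ)
  obtain ⟨X', hX', -⟩ := existsUnique_sylvester hA hM.transpose (B * N'ᵀ - X * M'ᵀ)
  have dP : HasDirDerivAt reducedGramian (M, N) (M', N') P' := by
    refine hasDirDerivAt_reducedGramian hM ?_
    rw [← hP]
    rw [← sub_eq_zero] at hP' ⊢
    rw [← hP']
    abel
  have dX : HasDirDerivAt (crossGramian A B) (M, N) (M', N') X' := by
    refine hasDirDerivAt_crossGramian hA hM ?_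
    rw [← hX]
    rw [← sub_eq_zero] at hX' ⊢
    rw [← hX']
    abel
  have h2 := hasDirDerivAt_snd (M, N) (M', N')
  have d := ((HasDirDerivAt.const (Bᵀ * sylvesterSolution A Aᵀ (B * Bᵀ) * B).trace).sub
    ((((HasDirDerivAt.const Bᵀ).matrix_mul dX).matrix_mul h2).matrix_trace.const_smul 2)).add
      ((h2.matrix_transpose.matrix_mul dP).matrix_mul h2).matrix_trace
  have hev : objectiveExt A B =ᶠ[nhds (M, N)] fun y =>
      (Bᵀ * sylvesterSolution A Aᵀ (B * Bᵀ) * B).trace -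
      (2 : ℝ) • (Bᵀ * crossGramian A B y * y.2).trace +
        (y.2ᵀ * reducedGramian y * y.2).trace := by
    filter_upwards [continuous_fst.continuousAt.eventually
      ((isOpen_strictlyAccretive r).mem_nhds hM)] with y hy
    exact objectiveExt_eq_gramians hA hy
  have d' := d.congr_of_eventuallyEq hev
  simp only [← hP, ← hX] at d'
  -- Symmetry of `M` enters the equations only after differentiation, since it fails at nearby
  -- points.
  rw [hMs] at eP eX hP' hX'
  convert d' using 1
  -- the identity between the traces
  have p1 : (N'ᵀ * P * N).trace = (N'ᵀ * (P * N)).trace := by rw [Matrix.mul_assoc]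
  have p2 : (Nᵀ * P * N').trace = (N'ᵀ * (P * N)).trace := by
    rw [← Matrix.trace_transpose]
    simp [Matrix.mul_assoc, hPt]
  -- Replace `N Nᵀ` by `M P + P M`, move the Sylvester operator onto `P'` by cyclicity of the trace,
  -- and insert the equation for `P'`.
  have p3 : (Nᵀ * P' * N).trace = 2 * (N'ᵀ * (P * N)).trace - 2 * (M'ᵀ * (P * P)).trace := by
    have e1 : (Nᵀ * P' * N).trace = (P' * (N * Nᵀ)).trace := by
      rw [Matrix.mul_assoc, Matrix.trace_mul_comm, Matrix.mul_assoc]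
    have e2 : (P' * (M * P + P * M)).trace = ((M * P' + P' * M) * P).trace := by
      rw [Matrix.mul_add, Matrix.add_mul, Matrix.trace_add, Matrix.trace_add, ← Matrix.mul_assoc,
        ← Matrix.mul_assoc, Matrix.trace_mul_comm (P' * P) M, add_comm, Matrix.mul_assoc M P' P]
    have e3 : (N' * Nᵀ * P).trace = (N'ᵀ * (P * N)).trace := by
      rw [Matrix.mul_assoc, Matrix.trace_mul_comm, ← Matrix.trace_transpose]
      simp [hPt]
    have e4 : (N * N'ᵀ * P).trace = (N'ᵀ * (P * N)).trace := by
      rw [Matrix.mul_assoc, Matrix.trace_mul_comm, Matrix.mul_assoc]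
    have e5 : (M' * P * P).trace = (M'ᵀ * (P * P)).trace := by
      rw [← Matrix.trace_transpose, ← Matrix.trace_mul_comm (P * P)]
      simp [hPt, Matrix.mul_assoc]
    have e6 : (P * M'ᵀ * P).trace = (M'ᵀ * (P * P)).trace := by
      rw [Matrix.mul_assoc, Matrix.trace_mul_comm, Matrix.mul_assoc]
    rw [e1, ← eP, e2, hP', Matrix.sub_mul, Matrix.sub_mul, Matrix.add_mul, Matrix.trace_sub,
      Matrix.trace_sub, Matrix.trace_add, e3, e4, e5, e6]
    ring
  have x1 : (Bᵀ * X * N').trace = (N'ᵀ * (Xᵀ * B)).trace := by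
    rw [← Matrix.trace_transpose]
    simp
  -- The same argument, with `B Nᵀ = A X + X M` paired against `X'`.
  have x2 : (Bᵀ * X' * N).trace = (N'ᵀ * (Xᵀ * B)).trace - (M'ᵀ * (Xᵀ * X)).trace := by
    have e1 : (Bᵀ * X' * N).trace = (X' * (B * Nᵀ)ᵀ).trace := by
      rw [Matrix.mul_assoc, Matrix.trace_mul_comm, Matrix.mul_assoc]
      simp
    have e2 : (X' * (A * X + X * M)ᵀ).trace = ((A * X' + X' * M) * Xᵀ).trace := by
      rw [Matrix.transpose_add, Matrix.transpose_mul, Matrix.transpose_mul, hAs, hMs,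
        Matrix.mul_add, Matrix.add_mul, Matrix.trace_add, Matrix.trace_add, ← Matrix.mul_assoc,
        ← Matrix.mul_assoc, Matrix.trace_mul_comm (X' * Xᵀ) A, Matrix.mul_assoc A X' Xᵀ]
    have e3 : (B * N'ᵀ * Xᵀ).trace = (N'ᵀ * (Xᵀ * B)).trace := by
      rw [Matrix.mul_assoc, Matrix.trace_mul_comm, Matrix.mul_assoc]
    have e4 : (X * M'ᵀ * Xᵀ).trace = (M'ᵀ * (Xᵀ * X)).trace := by
      rw [Matrix.mul_assoc, Matrix.trace_mul_comm, Matrix.mul_assoc]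
    rw [e1, ← eX, e2, hX', Matrix.sub_mul, Matrix.trace_sub, e3, e4]
  simp only [Matrix.zero_mul, zero_add, Matrix.add_mul, Matrix.trace_add, p1, p2, p3, x1, x2,
    Matrix.mul_sub, Matrix.mul_smul, Matrix.trace_sub, Matrix.trace_smul, smul_eq_mul, pow_two]
  ring

theorem hasEuclideanGradientAt_objectiveExt (hA : StrictlyAccretive A) (hAs : Aᵀ = A)
    (hM : StrictlyAccretive M) (hMs : Mᵀ = M)
    {P : Matrix (Fin r) (Fin r) ℝ} {X : Matrix (Fin n) (Fin r) ℝ}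
    (hP : P = reducedGramian (M, N)) (hX : X = crossGramian A B (M, N)) :
    HasEuclideanGradientAt (objectiveExt A B) (M, N)
      ((-2 : ℝ) • (P ^ 2 - Xᵀ * X), (4 : ℝ) • (P * N) - (4 : ℝ) • (Xᵀ * B)) :=
  have h := fun M' N' => hasDirDerivAt_objectiveExt (M' := M') (N' := N') hA hAs hM hMs hP hX
  ⟨(h 0 0).1, fun M' N' => (h M' N').2⟩

end Gradient

/-! ### The Levi-Civita connection, the Riemannian gradient and the Hessian -/

section Riemannian

variable {n m r : ℕ}

/-- The Christoffel map `Γ_S(ξ, η) = -sym(ξ S⁻¹ η)` of the affine-invariant metric, extended by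
zero to the flat factor. -/
noncomputable def affineInvariantChristoffel (r m : ℕ) (x : TangentModel r m) :
    TangentModel r m →ₗ[ℝ] TangentModel r m →ₗ[ℝ] TangentModel r m :=
  LinearMap.mk₂ ℝ
    (fun u v => (-symProj r ((u.1 : Matrix (Fin r) (Fin r) ℝ) *
      (x.1 : Matrix (Fin r) (Fin r) ℝ)⁻¹ * (v.1 : Matrix (Fin r) (Fin r) ℝ)), 0))
    (by intro u v w; simp [Matrix.add_mul, add_comm])
    (by intro c u v; simp)
    (by intro u v w; simp [Matrix.mul_add, add_comm])
    (by intro c u v; simp)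

theorem affineInvariantChristoffel_apply (x u v : TangentModel r m) :
    affineInvariantChristoffel r m x u v = (-symProj r ((u.1 : Matrix (Fin r) (Fin r) ℝ) *
      (x.1 : Matrix (Fin r) (Fin r) ℝ)⁻¹ * (v.1 : Matrix (Fin r) (Fin r) ℝ)), 0) := rfl

theorem affineInvariantForm_apply (x v w : TangentModel r m) :
    affineInvariantForm r m x v w =
      ((x.1 : Matrix (Fin r) (Fin r) ℝ)⁻¹ * (v.1 : Matrix (Fin r) (Fin r) ℝ) *
        (x.1 : Matrix (Fin r) (Fin r) ℝ)⁻¹ * (w.1 : Matrix (Fin r) (Fin r) ℝ)).trace +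
      (v.2ᵀ * w.2).trace := rfl

theorem hasDirDerivAt_coe_fst (x u : TangentModel r m) :
    HasDirDerivAt (fun y : TangentModel r m => (y.1 : Matrix (Fin r) (Fin r) ℝ)) x u u.1 :=
  (hasDirDerivAt_fst x u).clm (SymMat r).subtypeL

theorem symPart_transpose (Z : Matrix (Fin r) (Fin r) ℝ) : symPart Zᵀ = symPart Z := by
  simp [symPart, add_comm]

/-- For symmetric arguments, transposing `u S⁻¹ v` exchanges `u` and `v`, and `sym` does not see
transposition; this gives torsion-freeness. Compatibility follows from `D(S⁻¹)[u] = -S⁻¹ u S⁻¹`: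
each of the two resulting traces appears as two halves on the right. -/
theorem isLeviCivita_affineInvariantChristoffel (r m : ℕ) :
    (reducedMetric r m).IsLeviCivita (affineInvariantChristoffel r m) where
  torsion_free x _ u v := by
    rw [affineInvariantChristoffel_apply, affineInvariantChristoffel_apply]
    refine Prod.ext (congrArg Neg.neg (Subtype.ext ?_)) rfl
    rw [coe_symProj, coe_symProj, ← symPart_transpose]
    have hu : (u.1 : Matrix (Fin r) (Fin r) ℝ)ᵀ = u.1 := u.1.2
    have hv : (v.1 : Matrix (Fin r) (Fin r) ℝ)ᵀ = v.1 := v.1.2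
    have hx : (x.1 : Matrix (Fin r) (Fin r) ℝ)ᵀ = x.1 := x.1.2
    simp only [Matrix.transpose_mul, Matrix.transpose_nonsing_inv, hu, hv, hx, Matrix.mul_assoc]
  metric x hx u v w := by
    have hS : IsUnit (x.1 : Matrix (Fin r) (Fin r) ℝ) :=
      (show (x.1 : Matrix (Fin r) (Fin r) ℝ).PosDef from hx).isUnit
    have hu : (u.1 : Matrix (Fin r) (Fin r) ℝ)ᵀ = u.1 := u.1.2
    have hv : (v.1 : Matrix (Fin r) (Fin r) ℝ)ᵀ = v.1 := v.1.2
    have hw : (w.1 : Matrix (Fin r) (Fin r) ℝ)ᵀ = w.1 := w.1.2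
    have hxt : (x.1 : Matrix (Fin r) (Fin r) ℝ)ᵀ = x.1 := x.1.2
    have d1 := (hasDirDerivAt_coe_fst x u).matrix_inv hS
    have d := ((((d1.matrix_mul (.const (v.1 : Matrix (Fin r) (Fin r) ℝ))).matrix_mul
      d1).matrix_mul (.const (w.1 : Matrix (Fin r) (Fin r) ℝ))).matrix_trace).add
        (.const (v.2ᵀ * w.2).trace)
    refine d.2.trans ?_
    change _ = affineInvariantForm r m x (affineInvariantChristoffel r m x u v) w +
      affineInvariantForm r m x v (affineInvariantChristoffel r m x u w)
    simp only [affineInvariantForm_apply, affineInvariantChristoffel_apply, NegMemClass.coe_neg,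
      coe_symProj, symPart, Matrix.transpose_mul, Matrix.transpose_nonsing_inv, hu, hv, hw, hxt]
    generalize (x.1 : Matrix (Fin r) (Fin r) ℝ)⁻¹ = T
    generalize (u.1 : Matrix (Fin r) (Fin r) ℝ) = a
    generalize (v.1 : Matrix (Fin r) (Fin r) ℝ) = b
    generalize (w.1 : Matrix (Fin r) (Fin r) ℝ) = c
    -- The four half-traces on the right match the two on the left up to this one cyclic rotation.
    have h1 : (T * (b * (T * (c * (T * a))))).trace = (T * (a * (T * (b * (T * c))))).trace := by
      have := Matrix.trace_mul_comm (T * (b * (T * c))) (T * a)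
      simpa only [Matrix.mul_assoc] using this
    simp [Matrix.mul_add, Matrix.add_mul, Matrix.mul_assoc, h1]
    ring

/-- The inclusion of `Sym(r) × ℝ^{r×m}` into `ℝ^{r×r} × ℝ^{r×m}`. -/
noncomputable def tangentInclusion (r m : ℕ) :
    TangentModel r m →L[ℝ] Matrix (Fin r) (Fin r) ℝ × Matrix (Fin r) (Fin m) ℝ :=
  (SymMat r).subtypeL.prodMap (ContinuousLinearMap.id ℝ _)

theorem tangentInclusion_apply (x : TangentModel r m) :
    tangentInclusion r m x = ((x.1 : Matrix (Fin r) (Fin r) ℝ), x.2) := rfl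

/-- The Riemannian gradient of the objective function. -/
noncomputable def riemannianGradient (A : Matrix (Fin n) (Fin n) ℝ) (B : Matrix (Fin n) (Fin m) ℝ)
    (x : TangentModel r m) : TangentModel r m :=
  (symProj r ((-2 : ℝ) • ((x.1 : Matrix (Fin r) (Fin r) ℝ) *
      symPart (reducedGramian (tangentInclusion r m x) * reducedGramian (tangentInclusion r m x) -
        (crossGramian A B (tangentInclusion r m x))ᵀ *
          crossGramian A B (tangentInclusion r m x)) * (x.1 : Matrix (Fin r) (Fin r) ℝ))),
    (4 : ℝ) • (reducedGramian (tangentInclusion r m x) * x.2) -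
      (4 : ℝ) • ((crossGramian A B (tangentInclusion r m x))ᵀ * B))

/-- Shows that the outer projection in `riemannianGradient` changes nothing; it only places the
value in `Sym(r)`. -/
theorem symPart_smul_mul_mul {S : Matrix (Fin r) (Fin r) ℝ} (hS : Sᵀ = S) (c : ℝ)
    (Q : Matrix (Fin r) (Fin r) ℝ) :
    symPart (c • (S * symPart Q * S)) = c • (S * symPart Q * S) := by
  refine symPart_of_isSymm ?_
  rw [Matrix.transpose_smul, Matrix.transpose_mul, Matrix.transpose_mul, transpose_symPart, hS,
    Matrix.mul_assoc]

variable {A : Matrix (Fin n) (Fin n) ℝ} {B : Matrix (Fin n) (Fin m) ℝ}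

/-- The chain rule along the inclusion restricts the Euclidean derivative to symmetric directions,
which pair only with the symmetric part of the first component. The outer factors `S` cancel the two
`S⁻¹` of the metric. -/
theorem hasGradientAt_objective (hA : A.PosDef) {x : TangentModel r m}
    (hx : x ∈ reducedManifold r m) :
    (reducedMetric r m).HasGradientAt (objective A B) x (riemannianGradient A B x) := by
  have hAs : Aᵀ = A := Matrix.isHermitian_iff_isSymm.mp hA.1
  have hS : (x.1 : Matrix (Fin r) (Fin r) ℝ).PosDef := hx
  have hSs : (x.1 : Matrix (Fin r) (Fin r) ℝ)ᵀ = x.1 := x.1.2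
  have d := fun ξ : TangentModel r m =>
    (hasDirDerivAt_objectiveExt (M' := (ξ.1 : Matrix (Fin r) (Fin r) ℝ)) (N' := ξ.2) (N := x.2)
      (B := B) (.of_posDef hA) hAs (.of_posDef hS) hSs rfl rfl).comp_clm
        (L := tangentInclusion r m) (z := x) (k := ξ)
  refine ⟨(d 0).1, fun ξ => (d ξ).2.trans ?_⟩
  have hξ : (ξ.1 : Matrix (Fin r) (Fin r) ℝ)ᵀ = ξ.1 := ξ.1.2
  have hdet : IsUnit (x.1 : Matrix (Fin r) (Fin r) ℝ).det :=
    (Matrix.isUnit_iff_isUnit_det _).mp hS.isUnit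
  change _ = affineInvariantForm r m x (riemannianGradient A B x) ξ
  rw [affineInvariantForm_apply, riemannianGradient, coe_symProj, symPart_smul_mul_mul hSs,
    tangentInclusion_apply, pow_two]
  generalize reducedGramian ((x.1 : Matrix (Fin r) (Fin r) ℝ), x.2) = P
  generalize crossGramian A B ((x.1 : Matrix (Fin r) (Fin r) ℝ), x.2) = X
  congr 1
  · generalize P * P - Xᵀ * X = Q
    rw [hξ, Matrix.mul_smul, Matrix.mul_smul, Matrix.smul_mul, Matrix.smul_mul, Matrix.mul_assoc
      (x.1 : Matrix (Fin r) (Fin r) ℝ), Matrix.nonsing_inv_mul_cancel_left _ _ hdet,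
      Matrix.mul_nonsing_inv_cancel_right _ _ hdet, Matrix.trace_smul, Matrix.trace_smul, symPart,
      Matrix.smul_mul, Matrix.add_mul, Matrix.trace_smul, Matrix.trace_add]
    have h1 : (Qᵀ * (ξ.1 : Matrix (Fin r) (Fin r) ℝ)).trace =
        ((ξ.1 : Matrix (Fin r) (Fin r) ℝ) * Q).trace := by
      rw [← Matrix.trace_transpose, Matrix.transpose_mul, Matrix.transpose_transpose, hξ]
    rw [h1, Matrix.trace_mul_comm Q]
    simp only [smul_eq_mul]
    ring
  · rw [← Matrix.trace_transpose]
    simp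

theorem hasDirDerivAt_symPart {E : Type*} [NormedAddCommGroup E] [NormedSpace ℝ E]
    {f : E → Matrix (Fin r) (Fin r) ℝ} {x h : E} {v : Matrix (Fin r) (Fin r) ℝ}
    (hf : HasDirDerivAt f x h v) : HasDirDerivAt (fun y => symPart (f y)) x h (symPart v) :=
  (hf.clm (symProj r)).clm (SymMat r).subtypeL

theorem hasDirDerivAt_riemannianGradient {x ξ : TangentModel r m}
    {S S' P P' : Matrix (Fin r) (Fin r) ℝ} {X X' : Matrix (Fin n) (Fin r) ℝ}
    (hS : S = x.1) (hS' : S' = ξ.1)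
    (hP : P = reducedGramian (tangentInclusion r m x))
    (hX : X = crossGramian A B (tangentInclusion r m x))
    (dP : HasDirDerivAt reducedGramian (tangentInclusion r m x) (tangentInclusion r m ξ) P')
    (dX : HasDirDerivAt (crossGramian A B) (tangentInclusion r m x) (tangentInclusion r m ξ) X') :
    HasDirDerivAt (riemannianGradient A B) x ξ
      (symProj r ((-2 : ℝ) • ((S' * symPart (P * P - Xᵀ * X) +
        S * symPart (P' * P + P * P' - (X'ᵀ * X + Xᵀ * X'))) * S +
          S * symPart (P * P - Xᵀ * X) * S')),
        (4 : ℝ) • (P' * x.2 + P * ξ.2) - (4 : ℝ) • (X'ᵀ * B)) := by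
  subst hS hS' hP hX
  have dP := dP.comp_clm
  have dX := dX.comp_clm
  have dS := hasDirDerivAt_coe_fst x ξ
  have d2 := hasDirDerivAt_snd x ξ
  have dN := hasDirDerivAt_symPart ((dP.matrix_mul dP).sub (dX.matrix_transpose.matrix_mul dX))
  have e2 := ((dP.matrix_mul d2).const_smul 4).sub
    ((dX.matrix_transpose.matrix_mul (.const B)).const_smul 4)
  rw [Matrix.mul_zero, add_zero] at e2
  exact ((((dS.matrix_mul dN).matrix_mul dS).const_smul (-2)).clm (symProj r)).prodMk e2

end Riemannian

/-! ### Assembly of the main theorem -/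

theorem mainTheorem3 {n m r : ℕ} (A : Matrix (Fin n) (Fin n) ℝ) (hA : A.PosDef)
    (B : Matrix (Fin n) (Fin m) ℝ) (x : TangentModel r m) (hx : x ∈ reducedManifold r m)
    (Ar : Matrix (Fin r) (Fin r) ℝ) (hAr : Ar = x.1)
    (Br : Matrix (Fin r) (Fin m) ℝ) (hBr : Br = x.2)
    (C : Matrix (Fin m) (Fin n) ℝ) (hC : C = Bᵀ)
    (Cr : Matrix (Fin m) (Fin r) ℝ) (hCr : Cr = Brᵀ) :
    -- the linear matrix equations are uniquely solvable
    (∃! P, SolvesP Ar Br P) ∧ (∃! Q, SolvesQ Ar Cr Q) ∧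
    (∃! X, SolvesX A B Ar Br X) ∧ (∃! Y, SolvesY A C Ar Cr Y) ∧
    (∀ P X, ∀ A' B', (∃! P', SolvesP' Ar Br P A' B' P') ∧ (∃! X', SolvesX' A B Ar X A' B' X')) ∧
    -- the error system has finite `H²` norm
    HasFiniteH2Norm (gradientErrorSystem A B Ar Br) ∧
    ∀ P Q X Y, SolvesP Ar Br P → SolvesQ Ar Cr Q → SolvesX A B Ar Br X → SolvesY A C Ar Cr Y →
      P = Q ∧ X = -Y ∧
      -- Euclidean gradient
      HasEuclideanGradientAt (objectiveExt A B) (Ar, Br)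
        ((-2 : ℝ) • (P ^ 2 - Xᵀ * X), (4 : ℝ) • (P * Br) - (4 : ℝ) • (Xᵀ * B)) ∧
      -- Riemannian gradient
      (∃ V : TangentModel r m, (reducedMetric r m).HasGradientAt (objective A B) x V ∧
        (V.1 : Matrix (Fin r) (Fin r) ℝ) = (-2 : ℝ) • (Ar * symPart (P ^ 2 - Xᵀ * X) * Ar) ∧
        V.2 = (4 : ℝ) • (P * Br) - (4 : ℝ) • (Xᵀ * B)) ∧
      -- Riemannian Hessian in the direction `(A', B')`
      ∀ (ξ : TangentModel r m) (A' : Matrix (Fin r) (Fin r) ℝ) (B' : Matrix (Fin r) (Fin m) ℝ),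
        A' = ξ.1 → B' = ξ.2 → ∀ P' X', SolvesP' Ar Br P A' B' P' → SolvesX' A B Ar X A' B' X' →
        ∃ W : TangentModel r m, (reducedMetric r m).HasHessianAt (objective A B) x ξ W ∧
          (W.1 : Matrix (Fin r) (Fin r) ℝ) =
            (-2 : ℝ) • (Ar * symPart (P' * P + P * P' - X'ᵀ * X - Xᵀ * X') * Ar) -
              (2 : ℝ) • symPart (A' * symPart (P ^ 2 - Xᵀ * X) * Ar) ∧
          W.2 = (4 : ℝ) • (P' * Br + P * B') - (4 : ℝ) • (X'ᵀ * B) := by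
  have hAs : Aᵀ = A := Matrix.isHermitian_iff_isSymm.mp hA.1
  have aA : StrictlyAccretive A := .of_posDef hA
  have hS : Ar.PosDef := by rw [hAr]; exact hx
  have hSs : Arᵀ = Ar := Matrix.isHermitian_iff_isSymm.mp hS.1
  have aS : StrictlyAccretive Ar := .of_posDef hS
  have hι : tangentInclusion r m x = (Ar, Br) := by rw [tangentInclusion_apply, hAr, hBr]
  subst hC hCr
  have uP : ∀ F : Matrix (Fin r) (Fin r) ℝ, ∃! P, Ar * P + P * Ar = F :=
    existsUnique_sylvester aS aS
  have uX : ∀ F : Matrix (Fin n) (Fin r) ℝ, ∃! X : Matrix (Fin n) (Fin r) ℝ,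
      A * X + X * Ar = F := existsUnique_sylvester aA aS
  refine ⟨?_, ?_, ?_, ?_, fun P X A' B' => ⟨?_, ?_⟩, ?_, ?_⟩
  · simpa only [SolvesP, sub_eq_zero] using uP (Br * Brᵀ)
  · simpa only [SolvesQ, sub_eq_zero] using uP (Brᵀᵀ * Brᵀ)
  · simpa only [SolvesX, sub_eq_zero] using uX (B * Brᵀ)
  · simpa only [SolvesY, ← eq_neg_iff_add_eq_zero] using uX (-(Bᵀᵀ * Brᵀ))
  · have h := uP (B' * Brᵀ + Br * B'ᵀ - A' * P - P * A')
    refine (existsUnique_congr fun Z => ?_).mpr h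
    rw [SolvesP', ← sub_eq_zero (b := B' * Brᵀ + Br * B'ᵀ - A' * P - P * A')]
    refine Iff.of_eq (congrArg (· = 0) ?_)
    abel
  · have h := uX (B * B'ᵀ - X * A')
    refine (existsUnique_congr fun Z => ?_).mpr h
    rw [SolvesX', ← sub_eq_zero (b := B * B'ᵀ - X * A')]
    refine Iff.of_eq (congrArg (· = 0) ?_)
    abel
  · exact (integral_frobeniusSq_gradientErrorSystem aA aS
      (sylvesterSolution_spec aA aA.transpose _) (sylvesterSolution_spec aA aS.transpose _)
      (sylvesterSolution_spec aS aS.transpose _)).1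
  intro P Q X Y hP hQ hX hY
  simp only [SolvesP, SolvesQ, SolvesX, sub_eq_zero, Matrix.transpose_transpose] at hP hQ hX
  simp only [SolvesY, ← eq_neg_iff_add_eq_zero, Matrix.transpose_transpose] at hY
  -- The Gramians are defined with a transpose on the right factor, suited to nonsymmetric matrices;
  -- at the symmetric `Ar` their equations are those of the theorem.
  have gP : P = reducedGramian (Ar, Br) := by
    refine eq_of_sylvester_eq aS aS (hP.trans ?_)
    have := sylvesterSolution_spec aS aS.transpose (Br * Brᵀ)
    rw [← this, hSs]
    simp only [reducedGramian, hSs]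
  have gX : X = crossGramian A B (Ar, Br) := by
    refine eq_of_sylvester_eq aA aS (hX.trans ?_)
    have := sylvesterSolution_spec aA aS.transpose (B * Brᵀ)
    rw [← this, hSs]
    simp only [crossGramian, hSs]
  have hV1 : ((riemannianGradient A B x).1 : Matrix (Fin r) (Fin r) ℝ) =
      (-2 : ℝ) • (Ar * symPart (P ^ 2 - Xᵀ * X) * Ar) := by
    rw [riemannianGradient, hι, ← gP, ← gX, ← hAr, coe_symProj, symPart_smul_mul_mul hSs, pow_two]
  refine ⟨eq_of_sylvester_eq aS aS (hP.trans hQ.symm), ?_,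
    hasEuclideanGradientAt_objectiveExt aA hAs aS hSs gP gX,
    ⟨riemannianGradient A B x, hasGradientAt_objective hA hx, hV1, ?_⟩, ?_⟩
  · refine eq_of_sylvester_eq aA aS (hX.trans ?_)
    rw [Matrix.mul_neg, Matrix.neg_mul, ← neg_add, hY, neg_neg]
  · rw [riemannianGradient, hι, ← gP, ← gX, ← hBr]
  intro ξ A' B' hA' hB' P' X' hP' hX'
  rw [SolvesP'] at hP'
  rw [SolvesX'] at hX'
  -- Tangent directions are symmetric, so the linearized Gramian equations lose their transposes and
  -- become those for `P'` and `X'`.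
  have hA's : A'ᵀ = A' := by rw [hA']; exact ξ.1.2
  have hιξ : tangentInclusion r m ξ = (A', B') := by rw [tangentInclusion_apply, hA', hB']
  have dP : HasDirDerivAt reducedGramian (tangentInclusion r m x) (tangentInclusion r m ξ) P' := by
    rw [hι, hιξ]
    refine hasDirDerivAt_reducedGramian aS ?_
    rw [← gP, hSs, hA's, ← sub_eq_zero, ← hP']
    abel
  have dX : HasDirDerivAt (crossGramian A B) (tangentInclusion r m x) (tangentInclusion r m ξ)
      X' := by
    rw [hι, hιξ]
    refine hasDirDerivAt_crossGramian aA aS ?_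
    rw [← gX, hSs, hA's, ← sub_eq_zero, ← hX']
    abel
  have dV := hasDirDerivAt_riemannianGradient hAr hA' (gP.trans (by rw [hι]))
    (gX.trans (by rw [hι])) dP dX
  refine ⟨_, ⟨riemannianGradient A B, affineInvariantChristoffel r m,
    fun y hy => hasGradientAt_objective hA hy, isLeviCivita_affineInvariantChristoffel r m,
    dV.1, rfl⟩, ?_, ?_⟩
  · rw [dV.2, affineInvariantChristoffel_apply, Prod.fst_add, Submodule.coe_add,
      NegMemClass.coe_neg, coe_symProj, coe_symProj, hV1, ← hAr, ← hA', ← pow_two P]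
    have hdet : IsUnit Ar.det := (Matrix.isUnit_iff_isUnit_det _).mp hS.isUnit
    have hPt : Pᵀ = P := by rw [gP]; exact transpose_reducedGramian aS
    -- With `N = sym(P² - Xᵀ X)`, the product rule contributes `-4 sym(A' N Ar)` and the Christoffel
    -- term `+2 sym(A' N Ar)`, which leaves the coefficient `-2`.
    have e1 : A' * Ar⁻¹ * ((-2 : ℝ) • (Ar * symPart (P ^ 2 - Xᵀ * X) * Ar)) =
        (-2 : ℝ) • (A' * symPart (P ^ 2 - Xᵀ * X) * Ar) := by
      rw [Matrix.mul_smul, Matrix.mul_assoc A', Matrix.mul_assoc Ar,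
        Matrix.nonsing_inv_mul_cancel_left _ _ hdet, Matrix.mul_assoc]
    have hD := transpose_symPart (P' * P + P * P' - X'ᵀ * X - Xᵀ * X')
    have hN := transpose_symPart (P ^ 2 - Xᵀ * X)
    rw [e1, ← sub_sub]
    generalize symPart (P' * P + P * P' - X'ᵀ * X - Xᵀ * X') = D at hD ⊢
    generalize symPart (P ^ 2 - Xᵀ * X) = N at hN ⊢
    simp only [symPart, Matrix.transpose_smul, Matrix.transpose_add, Matrix.transpose_mul, hSs,
      hA's, hD, hN, Matrix.add_mul, Matrix.mul_assoc]
    module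
  · rw [dV.2, affineInvariantChristoffel_apply, Prod.snd_add, ← hBr, ← hB', add_zero]
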